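/- Let $M>0$, $l>0$, $a\ge -1$, put $f(r)=1-\frac{2M}{r}+\frac{r^2}{l^2}$ and let $r_+>0$ be the positive zero of $f$. Consider the Schwarzschild-AdS metric of mass $M$ and cosmological constant $-3/l^2$ in ingoing Eddington–Finkelstein coordinates $(v,r,\theta,\varphi)$, $$g=-f(r)\,dv^2+2\,dv\,dr+r^2(d\theta^2+\sin^2\theta\,d\varphi^2);$$ equivalently $g=-f\,dU\,dv+r^2(d\theta^2+\sin^2\theta\,d\varphi^2)$ with $r_U=-r_v=-\frac12 f$ in the double null Eddington–Finkelstein coordinates $(U,v)$. For a function $\psi=\psi(v,r)$ define the energy flux through the part of the ingoing null cone of constant $v$ outside the horizon, $$\mathbb F[\psi](v)=\int_{r_+}^{\infty}\Big(r^4(\partial_r\psi)^2+r^2\psi^2\Big)(v,r)\,dr\in[0,\infty].$$ Then there are constants $B,c>0$ depending only on $M$, $l$ and $a$ with the following property. Let $v_0\in\mathbb R$ and let $\psi=\psi(v,r)$ be a spherically symmetric solution of $$\Box_g\psi-\frac{2a}{l^2}\psi=0$$ on the exterior region $\{v\ge v_0,\ r\ge r_+\}$ to the future of the cone $v=v_0$,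 which is $C^2$ up to and including the event horizon $r=r_+$ and the initial cone, and which satisfies the Dirichlet boundary condition at infinity in the sense that $\mathbb F[\psi](v)$ and $\mathbb F[\partial_v\psi](v)$ are finite and bounded on every interval $[v_0,v_1]$ (where $\partial_v$ is taken at fixed $r$, that is, along the stationary Killing field). Then for all $v\ge v_0$ and all $r\ge r_+$ $$\mathbb F[\psi](v)\le B\,e^{-c(v-v_0)}\,\mathbb F[\psi](v_0),\qquad |\psi(v,r)|\le B\,e^{-c(v-v_0)}\,r^{-3/2}\sqrt{\mathbb F[\psi](v_0)} .$$ -/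

import Mathlib

open MeasureTheory Set

noncomputable section

namespace SchwarzschildAdS

/-- The function `1 - 2M/r + r²/l²` (written `1 - μ`) of the Schwarzschild-AdS metric. -/
def lapse (M l r : ℝ) : ℝ := 1 - 2 * M / r + r ^ 2 / l ^ 2

/-- The Schwarzschild-AdS metric in ingoing Eddington-Finkelstein coordinates
`x = (v, r, θ, φ)`, namely `g = -(1-μ) dv² + 2 dv dr + r² (dθ² + sin² θ dφ²)`.
With `U` defined by `dU = dv - 2 dr / (1-μ)` it is `-(1-μ) dU dv + r² (dθ² + sin² θ dφ²)`, so that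
`r_U = -r_v = -(1-μ)/2` in the double null coordinates `(U, v)`, with the same `v`. The coordinates
`(v, r)` stay regular at the future event horizon. -/
def metric (M l : ℝ) (x : Fin 4 → ℝ) : Matrix (Fin 4) (Fin 4) ℝ :=
  !![-lapse M l (x 1), 1, 0, 0;
     1, 0, 0, 0;
     0, 0, (x 1) ^ 2, 0;
     0, 0, 0, (x 1) ^ 2 * Real.sin (x 2) ^ 2]

/-- The partial derivative in the `μ`-th coordinate. -/
def coordDeriv (μ : Fin 4) (h : (Fin 4 → ℝ) → ℝ) (x : Fin 4 → ℝ) : ℝ :=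
  deriv (fun s => h (Function.update x μ s)) (x μ)

/-- The wave operator `□_g ψ = |det g|^(-1/2) ∂_μ (|det g|^(1/2) g^{μν} ∂_ν ψ)` of a
Lorentzian metric `g` given in a coordinate chart. -/
def waveOp (g : (Fin 4 → ℝ) → Matrix (Fin 4) (Fin 4) ℝ) (ψ : (Fin 4 → ℝ) → ℝ)
    (x : Fin 4 → ℝ) : ℝ :=
  (Real.sqrt |(g x).det|)⁻¹ *
    ∑ μ, coordDeriv μ
      (fun y => Real.sqrt |(g y).det| * ∑ ν, (g y)⁻¹ μ ν * coordDeriv ν ψ y) x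

/-- The spherically symmetric scalar field on spacetime given by a function of `(v, r)`. -/
def symmField (Ψ : ℝ → ℝ → ℝ) (x : Fin 4 → ℝ) : ℝ := Ψ (x 0) (x 1)

/-- The (nondegenerate, `r`-weighted) energy flux of `Ψ` through the part of the ingoing null cone
`{v = const}` outside the horizon `r = rp`: `∫_{rp}^∞ (r⁴ (∂_r Ψ)² + r² Ψ²) dr`, with `∂_r` taken at
fixed `v`. As `∂_r = (1 / r_u) ∂_u` along the cone, in any null coordinate `u` this is
`∫ (r⁴ (∂_u Ψ)² / (-r_u) + r² Ψ² (-r_u)) du`. -/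
def flux (rp : ℝ) (Ψ : ℝ → ℝ → ℝ) (v : ℝ) : ENNReal :=
  ∫⁻ r in Ioi rp, ENNReal.ofReal (r ^ 4 * (deriv (fun s => Ψ v s) r) ^ 2 + r ^ 2 * (Ψ v r) ^ 2)

/-- The derivative along the stationary Killing field `∂_t`, which is `∂_v` at fixed `r`
(one-sided on the initial cone `v = v0`). -/
def killingDeriv (v0 : ℝ) (Ψ : ℝ → ℝ → ℝ) (v r : ℝ) : ℝ :=
  derivWithin (fun w => Ψ w r) (Ici v0) v

/-- Spherically symmetric solutions of `□_g ψ - (2a/l²) ψ = 0` on the exterior region `r ≥ rp` to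
the future of the ingoing null cone `v = v0`: twice continuously differentiable up to and including
the future event horizon and the initial cone, with the Dirichlet condition at infinity expressed by
the finiteness, locally uniformly in `v`, of the weighted energies of `ψ` and of `∂_t ψ`. -/
structure IsSolution (M l a rp v0 : ℝ) (Ψ : ℝ → ℝ → ℝ) : Prop where
  contDiffOn : ContDiffOn ℝ 2 (fun p : ℝ × ℝ => Ψ p.1 p.2) (Ici v0 ×ˢ Ici rp)
  wave_eq : ∀ x : Fin 4 → ℝ, v0 < x 0 → rp < x 1 → 0 < x 2 → x 2 < Real.pi →
    waveOp (metric M l) (symmField Ψ) x - 2 * a / l ^ 2 * symmField Ψ x = 0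
  flux_bounded : ∀ v1 : ℝ, ∃ C : NNReal, ∀ v ∈ Icc v0 v1, flux rp Ψ v ≤ C
  flux_killingDeriv_bounded :
    ∀ v1 : ℝ, ∃ C : NNReal, ∀ v ∈ Icc v0 v1, flux rp (killingDeriv v0 Ψ) v ≤ C

end SchwarzschildAdS

end

/-! Writing φ = rψ, f = `lapse` and V = `potential`, the equation becomes 2φ_vr + (fφ_r)_r - Vφ = 0,
and V ≥ 0 because a ≥ -1. It suffices to find a density e comparable to r²φ_r² + φ² and a radial
current J with ∂_v e + ∂_r J ≤ -c₄ e, where J ≤ 0 on the horizon and -J = O(r)(φ_v² + r²φ_r² + φ²)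
at infinity. This is `EnergyCurrent`, constructed in `nonempty_energyCurrent`.

Three multipliers are combined. The Killing field gives fφ_r² + Vφ². The field h∂_r with h = 1 + εr
gives a bulk term of size r²φ_r² that does not degenerate at the horizon. Its zeroth order bulk term
loses only O(r⁻³)φ², which the Hardy flux Ωφ² repays; what remains is the cross term 2Ωφφ_r. Far out
the r²φ_r² term absorbs it. On bounded r a Morawetz multiplier built on a static solution is used:
if u is the positive static solution regular at the horizon and y = fu'/u, set n = fφ_r - yφ, so
that φ_v + n is u times the tortoise derivative of φ/u. The multiplier P(φ_v + n) - kφ_v with P =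
r^(-b), b large and k = P(r_+), controls n² without a zeroth order error. Since y ≥ 0, Ωφφ_r equals
a multiple of φn plus a nonnegative term, so a large Λ closes the estimate (`Weights.bulk_ge`).

The static solution is a Volterra series (`exists_riccati`). The bound y ≤ V(r_+)(r - r_+) keeps y/f
bounded up to the horizon.

The inequality is integrated against the cutoff 1 - r/N. The cutoff error is an average (1/N)∫ r g
over r ≤ N with g integrable, and tends to zero; this is where finiteness of the fluxes of ψ and
∂_vψ enters, and no constant depends on their size. Grönwall gives exponential decay
(`EnergyCurrent.integral_density_le`), and a one-dimensional estimate on [r, 2r] gives the pointwise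
bound (`RescaledField.mul_sq_le`). -/

noncomputable section

namespace SchwarzschildAdS

/-! ### The static solution regular at the horizon and its Riccati variable -/

/-- The logarithmic `r`-derivative kernel of the Volterra iteration for the static solution that is
regular at the horizon. -/
def staticKernel (rp : ℝ) (V G : ℝ → ℝ) (u : ℝ → ℝ) (s : ℝ) : ℝ :=
  (∫ θ in (0 : ℝ)..1, V (rp + (s - rp) * θ) * u (rp + (s - rp) * θ)) / G s

/-- The terms of the Volterra series for the static solution that is regular at the horizon. -/
def staticTerm (rp : ℝ) (V G : ℝ → ℝ) : ℕ → ℝ → ℝ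
  | 0 => fun _ => 1
  | n + 1 => fun r => ∫ s in rp..r, staticKernel rp V G (staticTerm rp V G n) s

section Static

variable {rp V0 G0 : ℝ} {V G : ℝ → ℝ}

theorem continuous_staticKernel (hV : Continuous V) (hG : Continuous G) (hGpos : ∀ s, G s ≠ 0)
    {u : ℝ → ℝ} (hu : Continuous u) : Continuous (staticKernel rp V G u) := by
  unfold staticKernel
  refine Continuous.div ?_ hG hGpos
  apply intervalIntegral.continuous_parametric_intervalIntegral_of_continuous'
  fun_prop

theorem continuous_staticTerm (hV : Continuous V) (hG : Continuous G) (hGpos : ∀ s, G s ≠ 0)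
    (n : ℕ) : Continuous (staticTerm rp V G n) := by
  induction n with
  | zero => exact continuous_const
  | succ n ih =>
    exact intervalIntegral.continuous_primitive
      (fun a b => (continuous_staticKernel hV hG hGpos ih).intervalIntegrable a b) rp

theorem hasDerivAt_staticTerm_succ (hV : Continuous V) (hG : Continuous G) (hGpos : ∀ s, G s ≠ 0)
    (n : ℕ) (r : ℝ) : HasDerivAt (staticTerm rp V G (n + 1))
      (staticKernel rp V G (staticTerm rp V G n) r) r :=
  (continuous_staticKernel hV hG hGpos (continuous_staticTerm hV hG hGpos n)).integral_hasStrictDerivAt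
    rp r |>.hasDerivAt

/-- Rescaling the interval from rp to s to [0, 1] absorbs the factor s - rp. With f = (s - rp)G the
kernel is thus (1/f)∫Vu, written so that it is visibly continuous at the horizon. -/
theorem mul_staticKernel (hGpos : ∀ s, G s ≠ 0) (u : ℝ → ℝ) (s : ℝ) :
    (s - rp) * G s * staticKernel rp V G u s = ∫ t in rp..s, V t * u t := by
  have h := intervalIntegral.smul_integral_comp_add_mul (a := (0 : ℝ)) (b := 1)
    (fun t => V t * u t) (s - rp) rp
  simp only [smul_eq_mul, mul_zero, add_zero, mul_one, add_sub_cancel] at h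
  rw [← h, staticKernel]
  have := hGpos s
  field_simp

theorem staticKernel_nonneg (hV0 : ∀ r, 0 ≤ V r) (hG0 : 0 < G0) (hG1 : ∀ r, G0 ≤ G r)
    {u : ℝ → ℝ} {s : ℝ} (hs : rp ≤ s) (hu : ∀ t ∈ Icc rp s, 0 ≤ u t) :
    0 ≤ staticKernel rp V G u s := by
  refine div_nonneg (intervalIntegral.integral_nonneg zero_le_one fun θ hθ => ?_)
    (hG0.le.trans (hG1 s))
  refine mul_nonneg (hV0 _) (hu _ ⟨?_, ?_⟩) <;> nlinarith [hθ.1, hθ.2]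

theorem staticKernel_le (hV : Continuous V) (hV0 : ∀ r, 0 ≤ V r)
    (hV1 : ∀ r, V r ≤ V0) (hG0 : 0 < G0) (hG1 : ∀ r, G0 ≤ G r)
    {u : ℝ → ℝ} (huc : Continuous u) {s m : ℝ} (hs : rp ≤ s)
    (hu : ∀ t ∈ Icc rp s, 0 ≤ u t) (hum : ∀ t ∈ Icc rp s, u t ≤ m) :
    staticKernel rp V G u s ≤ V0 * m / G0 := by
  have hV00 : 0 ≤ V0 := (hV0 0).trans (hV1 0)
  have hm : 0 ≤ m := (hu s ⟨hs, le_rfl⟩).trans (hum s ⟨hs, le_rfl⟩)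
  refine div_le_div₀ (mul_nonneg hV00 hm) ?_ hG0 (hG1 s)
  have hle : ∫ θ in (0 : ℝ)..1, V (rp + (s - rp) * θ) * u (rp + (s - rp) * θ)
      ≤ ∫ _ in (0 : ℝ)..1, V0 * m := by
    refine intervalIntegral.integral_mono_on zero_le_one
      (Continuous.intervalIntegrable (by fun_prop) _ _)
      (Continuous.intervalIntegrable (by fun_prop) _ _) fun θ hθ => ?_
    have hmem : rp + (s - rp) * θ ∈ Icc rp s := ⟨by nlinarith [hθ.1, hθ.2], by nlinarith [hθ.1, hθ.2]⟩
    exact mul_le_mul (hV1 _) (hum _ hmem) (hu _ hmem) hV00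
  simpa using hle

theorem staticTerm_bounds (hV : Continuous V) (hG : Continuous G) (hV0 : ∀ r, 0 ≤ V r)
    (hV1 : ∀ r, V r ≤ V0) (hG0 : 0 < G0) (hG1 : ∀ r, G0 ≤ G r) (n : ℕ) :
    ∀ r, rp ≤ r → 0 ≤ staticTerm rp V G n r ∧
      staticTerm rp V G n r ≤ (V0 / G0 * (r - rp)) ^ n / n.factorial := by
  have hGpos : ∀ s, G s ≠ 0 := fun s => (hG0.trans_le (hG1 s)).ne'
  have hV00 : 0 ≤ V0 := (hV0 0).trans (hV1 0)
  have hC : 0 ≤ V0 / G0 := by positivity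
  induction n with
  | zero => intro r _; simp [staticTerm]
  | succ n ih =>
    intro r hr
    have hk := continuous_staticKernel (rp := rp) hV hG hGpos
      (continuous_staticTerm (rp := rp) hV hG hGpos n)
    refine ⟨intervalIntegral.integral_nonneg hr fun s hs =>
      staticKernel_nonneg hV0 hG0 hG1 hs.1 fun t ht => (ih t ht.1).1, ?_⟩
    have hderiv : ∀ s ∈ uIcc rp r, HasDerivAt
        (fun s => (V0 / G0 * (s - rp)) ^ (n + 1) / (n + 1).factorial)
        (V0 / G0 * ((V0 / G0 * (s - rp)) ^ n / n.factorial)) s := by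
      intro s _
      have h := ((((hasDerivAt_id s).sub_const rp).const_mul (V0 / G0)).pow (n + 1)).div_const
        ((n + 1).factorial : ℝ)
      refine HasDerivAt.congr_deriv h ?_
      have : (n.factorial : ℝ) ≠ 0 := by positivity
      rw [Nat.factorial_succ]
      push_cast
      simp only [id]
      field_simp
    have hint : ∫ s in rp..r, V0 / G0 * ((V0 / G0 * (s - rp)) ^ n / n.factorial) =
        (V0 / G0 * (r - rp)) ^ (n + 1) / (n + 1).factorial := by
      rw [intervalIntegral.integral_eq_sub_of_hasDerivAt hderiv
        (Continuous.intervalIntegrable (by fun_prop) _ _)]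
      simp
    rw [← hint]
    refine intervalIntegral.integral_mono_on hr (hk.intervalIntegrable _ _)
      (Continuous.intervalIntegrable (by fun_prop) _ _) fun s hs => ?_
    refine (staticKernel_le hV hV0 hV1 hG0 hG1 (continuous_staticTerm hV hG hGpos n) hs.1
      (fun t ht => (ih t ht.1).1)
      (m := (V0 / G0 * (s - rp)) ^ n / n.factorial) fun t ht => (ih t ht.1).2.trans ?_).trans_eq ?_
    · gcongr
      · exact mul_nonneg hC (sub_nonneg.2 ht.1)
      · exact ht.2
    · ring

/-- Monotonicity lets ∫Vu over [rp, s] be bounded by the endpoint value u(s), which is the source of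
the linear bound on the Riccati variable. -/
theorem staticTerm_mono (hV : Continuous V) (hG : Continuous G) (hV0 : ∀ r, 0 ≤ V r)
    (hV1 : ∀ r, V r ≤ V0) (hG0 : 0 < G0) (hG1 : ∀ r, G0 ≤ G r) (n : ℕ) {t s : ℝ}
    (ht : rp ≤ t) (hts : t ≤ s) : staticTerm rp V G n t ≤ staticTerm rp V G n s := by
  have hGpos : ∀ s, G s ≠ 0 := fun s => (hG0.trans_le (hG1 s)).ne'
  cases n with
  | zero => simp [staticTerm]
  | succ n =>
    have hk := continuous_staticKernel (rp := rp) hV hG hGpos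
      (continuous_staticTerm (rp := rp) hV hG hGpos n)
    have hadd := intervalIntegral.integral_add_adjacent_intervals
      (hk.intervalIntegrable (μ := volume) rp t) (hk.intervalIntegrable (μ := volume) t s)
    have hnn : 0 ≤ ∫ x in t..s, staticKernel rp V G (staticTerm rp V G n) x :=
      intervalIntegral.integral_nonneg hts fun x hx => staticKernel_nonneg hV0 hG0 hG1
        (ht.trans hx.1) fun z hz => (staticTerm_bounds hV hG hV0 hV1 hG0 hG1 n z hz.1).1
    simp only [staticTerm]
    linarith

/-- The Riccati equation of the static solution which is regular at the horizon: it has a bounded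
solution on the whole exterior. -/
theorem exists_riccati (hV : Continuous V) (hG : Continuous G) (hV0 : ∀ r, 0 ≤ V r)
    (hV1 : ∀ r, V r ≤ V0) (hG0 : 0 < G0) (hG1 : ∀ r, G0 ≤ G r) :
    ∃ y : ℝ → ℝ, ContinuousOn y (Ici rp) ∧ y rp = 0 ∧
      (∀ r, rp < r → HasDerivAt y (V r - y r ^ 2 / ((r - rp) * G r)) r) ∧
      ∀ r, rp ≤ r → 0 ≤ y r ∧ y r ≤ V0 * (r - rp) := by
  have hGpos : ∀ s, G s ≠ 0 := fun s => (hG0.trans_le (hG1 s)).ne'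
  have hV00 : 0 ≤ V0 := (hV0 0).trans (hV1 0)
  have hC : 0 ≤ V0 / G0 := by positivity
  set u := staticTerm rp V G with hu
  have huc : ∀ n, Continuous (u n) := continuous_staticTerm hV hG hGpos
  have hub := staticTerm_bounds (rp := rp) hV hG hV0 hV1 hG0 hG1
  have hum := fun n => @staticTerm_mono rp V0 G0 V G hV hG hV0 hV1 hG0 hG1 n
  set w : ℕ → ℝ → ℝ := fun n s => ∫ t in rp..s, V t * u n t with hw
  have hwd : ∀ n s, HasDerivAt (w n) (V s * u n s) s := fun n s =>
    ((hV.mul (huc n)).integral_hasStrictDerivAt rp s).hasDerivAt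
  have hwk : ∀ n s, (s - rp) * G s * staticKernel rp V G (u n) s = w n s := fun n s =>
    mul_staticKernel hGpos (u n) s
  have hw0 : ∀ n s, rp ≤ s → 0 ≤ w n s := fun n s hs =>
    intervalIntegral.integral_nonneg hs fun t ht => mul_nonneg (hV0 t) (hub n t ht.1).1
  have hw1 : ∀ n s, rp ≤ s → w n s ≤ V0 * (s - rp) * u n s := by
    intro n s hs
    have : w n s ≤ ∫ _ in rp..s, V0 * u n s := by
      refine intervalIntegral.integral_mono_on hs ((hV.mul (huc n)).intervalIntegrable _ _)
        (Continuous.intervalIntegrable (by fun_prop) _ _) fun t ht => ?_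
      exact mul_le_mul (hV1 t) (hum n ht.1 ht.2) (hub n t ht.1).1 hV00
    refine this.trans_eq ?_
    simp
    ring
  have hsumb : ∀ x : ℝ, Summable fun n : ℕ => x ^ n / n.factorial :=
    Real.summable_pow_div_factorial
  have hsu : ∀ s, rp ≤ s → Summable fun n => u n s := fun s hs =>
    Summable.of_nonneg_of_le (fun n => (hub n s hs).1) (fun n => (hub n s hs).2) (hsumb _)
  have hsw : ∀ s, rp ≤ s → Summable fun n => w n s := fun s hs =>
    Summable.of_nonneg_of_le (fun n => hw0 n s hs) (fun n => hw1 n s hs) ((hsu s hs).mul_left _)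
  have hubR : ∀ R n s, s ∈ Ioo rp R → u n s ≤ (V0 / G0 * (R - rp)) ^ n / n.factorial := by
    intro R n s hs
    refine (hub n s hs.1.le).2.trans ?_
    gcongr
    · exact mul_nonneg hC (sub_nonneg.2 hs.1.le)
    · exact hs.2.le
  -- φ is the static solution with value 1 at the horizon and W is its flux (s - rp)Gφ'. The Riccati
  -- variable is W/φ, and `hw1`, summed over n, gives W ≤ V0(s - rp)φ.
  set φ : ℝ → ℝ := fun s => ∑' n, u n s with hφ
  set W : ℝ → ℝ := fun s => ∑' n, w n s with hW
  have hφ1 : ∀ s, rp ≤ s → 1 ≤ φ s := by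
    intro s hs
    have := (hsu s hs).le_tsum 0 (fun n _ => (hub n s hs).1)
    simpa [hu, staticTerm] using this
  have hWd : ∀ s, rp < s → HasDerivAt W (V s * φ s) s := by
    intro s hs
    have hmem : s ∈ Ioo rp (s + 1) := ⟨hs, by linarith⟩
    have := hasDerivAt_tsum_of_isPreconnected (g := w) (g' := fun n s => V s * u n s)
      ((hsumb (V0 / G0 * (s + 1 - rp))).mul_left V0) isOpen_Ioo isPreconnected_Ioo
      (fun n y _ => hwd n y) (fun n y hy => ?_) hmem (hsw s hs.le) hmem
    · rw [tsum_mul_left] at this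
      exact this
    · rw [Real.norm_of_nonneg (mul_nonneg (hV0 y) (hub n y hy.1.le).1)]
      exact mul_le_mul (hV1 y) (hubR _ n y hy) (hub n y hy.1.le).1 hV00
  have hφd : ∀ s, rp < s → HasDerivAt φ (W s / ((s - rp) * G s)) s := by
    intro s hs
    have hmem : s ∈ Ioo rp (s + 1) := ⟨hs, by linarith⟩
    have hkb : ∀ n y, y ∈ Ioo rp (s + 1) → ‖staticKernel rp V G (u n) y‖ ≤
        V0 / G0 * ((V0 / G0 * (s + 1 - rp)) ^ n / n.factorial) := by
      intro n y hy
      rw [Real.norm_of_nonneg (staticKernel_nonneg hV0 hG0 hG1 hy.1.le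
        fun t ht => (hub n t ht.1).1)]
      refine (staticKernel_le hV hV0 hV1 hG0 hG1 (huc n) hy.1.le (fun t ht => (hub n t ht.1).1)
        (fun t ht => (hum n ht.1 ht.2).trans (hubR _ n y hy))).trans_eq (by ring)
    have := hasDerivAt_tsum_of_isPreconnected (g := fun n => u (n + 1))
      (g' := fun n s => staticKernel rp V G (u n) s)
      ((hsumb (V0 / G0 * (s + 1 - rp))).mul_left (V0 / G0)) isOpen_Ioo isPreconnected_Ioo
      (fun n y _ => hasDerivAt_staticTerm_succ hV hG hGpos n y) hkb hmem
      ((summable_nat_add_iff 1).2 (hsu s hs.le)) hmem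
    have hne : (s - rp) * G s ≠ 0 := mul_ne_zero (sub_pos.2 hs).ne' (hGpos s)
    have hval : ∑' n, staticKernel rp V G (u n) s = W s / ((s - rp) * G s) := by
      rw [eq_div_iff hne, ← tsum_mul_right]
      exact tsum_congr fun n => by rw [← hwk n s]; ring
    rw [hval] at this
    -- The zeroth term of the series is the constant 1; the differentiated series starts at index 1.
    refine (this.const_add 1).congr_of_eventuallyEq ?_
    filter_upwards [isOpen_Ioi.mem_nhds hs] with z hz
    rw [hφ]
    simp only
    rw [(hsu z (le_of_lt hz)).tsum_eq_zero_add]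
    rfl
  have hy0 : ∀ s, rp ≤ s → 0 ≤ W s / φ s := fun s hs =>
    div_nonneg (tsum_nonneg fun n => hw0 n s hs) (zero_le_one.trans (hφ1 s hs))
  have hy1 : ∀ s, rp ≤ s → W s / φ s ≤ V0 * (s - rp) := by
    intro s hs
    rw [div_le_iff₀ (zero_lt_one.trans_le (hφ1 s hs)), hφ, ← tsum_mul_left]
    exact (hsw s hs).tsum_le_tsum (fun n => hw1 n s hs) ((hsu s hs).mul_left _)
  have hyrp : W rp / φ rp = 0 := le_antisymm (by simpa using hy1 rp le_rfl) (hy0 rp le_rfl)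
  have hyd : ∀ r, rp < r → HasDerivAt (fun s => W s / φ s)
      (V r - (W r / φ r) ^ 2 / ((r - rp) * G r)) r := by
    intro r hr
    have hφr : φ r ≠ 0 := (zero_lt_one.trans_le (hφ1 r hr.le)).ne'
    have hne : (r - rp) * G r ≠ 0 := mul_ne_zero (sub_pos.2 hr).ne' (hGpos r)
    refine HasDerivAt.congr_deriv ((hWd r hr).div (hφd r hr) hφr) ?_
    generalize (r - rp) * G r = x at hne
    generalize φ r = p at hφr
    generalize W r = q
    field_simp
  refine ⟨fun s => W s / φ s, fun s hs => ?_, hyrp, hyd, fun r hr => ⟨hy0 r hr, hy1 r hr⟩⟩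
  rcases eq_or_lt_of_le (mem_Ici.1 hs) with rfl | hlt
  · refine (tendsto_of_tendsto_of_tendsto_of_le_of_le' (g := fun _ => 0)
      (h := fun s => V0 * (s - rp)) ?_ ?_ ?_ ?_)
    · simpa only [hyrp] using tendsto_const_nhds
    · simp only [hyrp]
      refine (Continuous.tendsto' (by fun_prop) _ _ (by simp)).mono_left nhdsWithin_le_nhds
    · filter_upwards [self_mem_nhdsWithin] with z hz using hy0 z hz
    · filter_upwards [self_mem_nhdsWithin] with z hz using hy1 z hz
  · exact (hyd s hlt).continuousAt.continuousWithinAt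

end Static


/-! ### The lapse and the potential on the exterior -/

/-- The zeroth order coefficient of the equation for `r ψ`. -/
def potential (M l a r : ℝ) : ℝ := 2 * M / r ^ 3 + 2 * (1 + a) / l ^ 2

/-- The quotient `lapse / (r - rp)`. -/
def lapseQuot (l rp r : ℝ) : ℝ := (r ^ 2 + rp * r + rp ^ 2 + l ^ 2) / (l ^ 2 * r)

section Background

variable {M l a rp r : ℝ}

/-- The horizon condition eliminates M, so the cubic r · `lapse` factors through r - rp with a
cofactor positive for r > 0. All lower bounds on the lapse come from this. -/
theorem lapse_eq_mul (hl : 0 < l) (hrp : 0 < rp) (hhor : lapse M l rp = 0) (hr : 0 < r) :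
    lapse M l r = (r - rp) * lapseQuot l rp r := by
  unfold lapse lapseQuot at *
  field_simp at hhor ⊢
  linear_combination hhor

theorem lapseQuot_ge (hl : 0 < l) (hrp : 0 < rp) (hr : 0 < r) :
    (r + rp) / l ^ 2 ≤ lapseQuot l rp r := by
  unfold lapseQuot
  rw [div_le_div_iff₀ (by positivity) (by positivity)]
  nlinarith [show 0 < l ^ 2 * (rp ^ 2 + l ^ 2) by positivity]

theorem hasDerivAt_lapse (hr : r ≠ 0) :
    HasDerivAt (lapse M l) (2 * M / r ^ 2 + 2 * r / l ^ 2) r := by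
  unfold lapse
  have h := (((hasDerivAt_const r (1 : ℝ)).sub ((hasDerivAt_const r (2 * M)).div (hasDerivAt_id r)
    hr)).add ((hasDerivAt_pow 2 r).div_const (l ^ 2)))
  refine HasDerivAt.congr_deriv h ?_
  simp
  ring

theorem hasDerivAt_potential (hr : r ≠ 0) :
    HasDerivAt (potential M l a) (-6 * M / r ^ 4) r := by
  unfold potential
  have h := ((hasDerivAt_const r (2 * M)).div (hasDerivAt_pow 3 r) (pow_ne_zero 3 hr)).add_const
    (2 * (1 + a) / l ^ 2)
  refine HasDerivAt.congr_deriv h ?_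
  field_simp
  norm_num
  ring

theorem lapse_nonneg (hl : 0 < l) (hrp : 0 < rp) (hhor : lapse M l rp = 0) (hr : rp ≤ r) :
    0 ≤ lapse M l r := by
  have hr0 : 0 < r := hrp.trans_le hr
  rw [lapse_eq_mul hl hrp hhor hr0]
  exact mul_nonneg (sub_nonneg.2 hr) ((by positivity : 0 ≤ (r + rp) / l ^ 2).trans
    (lapseQuot_ge hl hrp hr0))

theorem lapse_le (hM : 0 < M) (hrp : 0 < rp) (hr : rp ≤ r) :
    lapse M l r ≤ (1 / rp ^ 2 + 1 / l ^ 2) * r ^ 2 := by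
  have hr0 : 0 < r := hrp.trans_le hr
  have h1 : 0 ≤ 2 * M / r := by positivity
  have h2 : 1 ≤ 1 / rp ^ 2 * r ^ 2 := by
    rw [one_div_mul_eq_div, one_le_div (by positivity)]
    gcongr
  unfold lapse
  have h3 : r ^ 2 / l ^ 2 = 1 / l ^ 2 * r ^ 2 := by ring
  linarith

theorem sq_le_lapse (hl : 0 < l) (hrp : 0 < rp) (hhor : lapse M l rp = 0) (hr : rp ≤ r) :
    (r ^ 2 - rp ^ 2) / l ^ 2 ≤ lapse M l r := by
  have hr0 : 0 < r := hrp.trans_le hr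
  rw [lapse_eq_mul hl hrp hhor hr0]
  refine (le_of_eq ?_).trans (mul_le_mul_of_nonneg_left (lapseQuot_ge hl hrp hr0)
    (sub_nonneg.2 hr))
  ring

theorem mul_le_lapse (hl : 0 < l) (hrp : 0 < rp) (hhor : lapse M l rp = 0) (hr : rp ≤ r) :
    (r - rp) * (r / l ^ 2) ≤ lapse M l r := by
  have hr0 : 0 < r := hrp.trans_le hr
  rw [lapse_eq_mul hl hrp hhor hr0]
  refine mul_le_mul_of_nonneg_left (le_trans ?_ (lapseQuot_ge hl hrp hr0)) (sub_nonneg.2 hr)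
  gcongr
  linarith

theorem lapse_pos (hl : 0 < l) (hrp : 0 < rp) (hhor : lapse M l rp = 0) (hr : rp < r) :
    0 < lapse M l r :=
  (mul_pos (sub_pos.2 hr) (div_pos (hrp.trans hr) (by positivity))).trans_le
    (mul_le_lapse hl hrp hhor hr.le)

theorem potential_nonneg (hM : 0 < M) (ha : -1 ≤ a) (hr : 0 < r) : 0 ≤ potential M l a r := by
  have : 0 ≤ 1 + a := by linarith
  unfold potential
  positivity

theorem potential_le (hM : 0 < M) (hrp : 0 < rp) (hr : rp ≤ r) :
    potential M l a r ≤ potential M l a rp := by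
  unfold potential
  gcongr

/-- The Riccati solution of the static problem on the Schwarzschild-AdS exterior. -/
theorem exists_static_riccati (hM : 0 < M) (hl : 0 < l) (ha : -1 ≤ a)
    (hrp : 0 < rp) (hhor : lapse M l rp = 0) :
    ∃ y : ℝ → ℝ, ContinuousOn y (Ici rp) ∧ y rp = 0 ∧
      (∀ r, rp < r → HasDerivAt y (potential M l a r - y r ^ 2 / lapse M l r) r) ∧
      ∀ r, rp ≤ r → 0 ≤ y r ∧ y r ≤ potential M l a rp * (r - rp) := by
  -- Freezing the coefficients at rp to the left of the horizon makes them continuous and bounded on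
  -- the whole line, as `exists_riccati` requires.
  have hpos : ∀ r : ℝ, 0 < max rp r := fun r => lt_max_of_lt_left hrp
  have hne : ∀ r : ℝ, max rp r ≠ 0 := fun r => (hpos r).ne'
  have hV : Continuous fun r => potential M l a (max rp r) := by
    unfold potential
    exact (continuous_const.div (by fun_prop) fun r => pow_ne_zero 3 (hne r)).add continuous_const
  have hG : Continuous fun r => lapseQuot l rp (max rp r) := by
    unfold lapseQuot
    exact Continuous.div (by fun_prop) (by fun_prop) fun r => mul_ne_zero (by positivity) (hne r)
  obtain ⟨y, hyc, hy0, hyd, hyb⟩ := exists_riccati (rp := rp) (V0 := potential M l a rp)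
    (G0 := rp / l ^ 2) hV hG (fun r => potential_nonneg hM ha (hpos r))
    (fun r => potential_le hM hrp (le_max_left _ _)) (by positivity) (fun r => by
      refine le_trans ?_ (lapseQuot_ge hl hrp (hpos r))
      gcongr
      linarith [hpos r])
  refine ⟨y, hyc, hy0, fun r hr => ?_, hyb⟩
  have := hyd r hr
  rwa [max_eq_right hr.le, ← lapse_eq_mul hl hrp hhor (hrp.trans hr)] at this

end Background

/-! ### Multiplier weights and the divergence identity -/

/-- The constants of the multiplier estimate: `ε` is the slope of the redshift weight, `C` and `δ`
enter the Hardy weight, `Λ` is the size of the static multiplier, `b` its decay rate and `k` its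
normalization at the horizon, `δ'` is the size of the Hardy term in the energy density. -/
structure Weights where
  (ε δ C Λ k δ' : ℝ)
  b : ℕ

namespace Weights

variable (w : Weights)

def h (r : ℝ) : ℝ := 1 + w.ε * r
def P (r : ℝ) : ℝ := (r ^ w.b)⁻¹
def q (r : ℝ) : ℝ := (w.k + w.P r) / 2
-- This Hardy weight vanishes at the horizon. The derivative of its second summand is 2C/r³, matched
-- to the loss in `weighted_potential_ge`; the first contributes the positive constant δ.
def Ω (rp r : ℝ) : ℝ := w.δ * (r - rp) + w.C * (1 / rp ^ 2 - 1 / r ^ 2)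

/-- The energy density, as a quadratic form in `(∂_r φ, φ)`. -/
def energy (f V y : ℝ → ℝ) (rp r p q : ℝ) : ℝ :=
  (f r + w.h r) * p ^ 2 + V r * q ^ 2
    + w.Λ * w.q r * (f r * p ^ 2 - 2 * y r * (p * q) + y r ^ 2 / f r * q ^ 2)
    + w.δ' * (q ^ 2 + 2 * (r - rp) * (p * q))

/-- The polarization of the energy density. -/
def energyDeriv (f V y : ℝ → ℝ) (rp r p q p' q' : ℝ) : ℝ :=
  2 * (f r + w.h r) * (p * p') + 2 * V r * (q * q')
    + w.Λ * w.q r * (2 * f r * (p * p') - 2 * y r * (p' * q + p * q')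
      + 2 * (y r ^ 2 / f r) * (q * q'))
    + w.δ' * (2 * (q * q') + 2 * (r - rp) * (p' * q + p * q'))

/-- The radial current, as a quadratic form in `(∂_v φ, ∂_r φ, φ)`. -/
def current (f V y : ℝ → ℝ) (rp r d p q : ℝ) : ℝ :=
  -2 * d ^ 2 - 2 * f r * (p * d) + w.h r / 2 * (f r * p ^ 2 - V r * q ^ 2)
    + w.Λ * (w.P r / 2 * (f r * p - y r * q) ^ 2 - (w.k - w.P r) * d ^ 2
      - (w.k - w.P r) * d * (f r * p - y r * q))
    - w.Ω rp r * q ^ 2 - 2 * w.δ' * (r - rp) * (q * d)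

/-- The spacetime density. -/
def bulk (f V y f' V' : ℝ → ℝ) (rp r d p q : ℝ) : ℝ :=
  (w.h r * f' r - w.ε * f r) / 2 * p ^ 2 + (w.ε * V r + w.h r * V' r) / 2 * q ^ 2
    + w.Λ * (w.P r / r) * (w.b / 4 * (f r * p - y r * q) ^ 2
      + w.b * (d + (f r * p - y r * q) / 2) ^ 2
      + 2 * (y r / f r * r) * ((f r * p - y r * q) * (d + (f r * p - y r * q) / 2)))
    + (w.δ + 2 * w.C / r ^ 3) * q ^ 2 + 2 * w.Ω rp r * (q * p)

theorem hasDerivAt_P {r : ℝ} (hr : r ≠ 0) : HasDerivAt w.P (-w.b * w.P r / r) r := by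
  unfold P
  refine HasDerivAt.congr_deriv ((hasDerivAt_pow w.b r).inv (pow_ne_zero _ hr)) ?_
  rcases Nat.eq_zero_or_pos w.b with h | h
  · simp [h]
  · obtain ⟨n, hn⟩ := Nat.exists_eq_succ_of_ne_zero h.ne'
    rw [hn]
    simp only [Nat.succ_eq_add_one, Nat.add_sub_cancel]
    field_simp
    ring

theorem hasDerivAt_Ω {rp r : ℝ} (hr : r ≠ 0) :
    HasDerivAt (w.Ω rp) (w.δ + 2 * w.C / r ^ 3) r := by
  unfold Ω
  have h := (((hasDerivAt_id r).sub_const rp).const_mul w.δ).add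
    (((hasDerivAt_const r (1 : ℝ)).div (hasDerivAt_pow 2 r) (pow_ne_zero 2 hr)).const_sub
      (1 / rp ^ 2) |>.const_mul w.C)
  refine HasDerivAt.congr_deriv h ?_
  field_simp
  norm_num
  ring

/-- The divergence identity. -/
theorem hasDerivAt_current {f V y f' V' : ℝ → ℝ} {rp r : ℝ} (hr : r ≠ 0) (hfr : f r ≠ 0)
    (hf : HasDerivAt f (f' r) r) (hV : HasDerivAt V (V' r) r)
    (hy : HasDerivAt y (V r - y r ^ 2 / f r) r)
    {φ φr φv : ℝ → ℝ} {prr pvr : ℝ} (hφ : HasDerivAt φ (φr r) r) (hφr : HasDerivAt φr prr r)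
    (hφv : HasDerivAt φv pvr r)
    (heq : 2 * pvr + f r * prr + f' r * φr r - V r * φ r = 0) :
    HasDerivAt (fun s => w.current f V y rp s (φv s) (φr s) (φ s))
      (-w.energyDeriv f V y rp r (φr r) (φ r) pvr (φv r)
        - w.bulk f V y f' V' rp r (φv r) (φr r) (φ r)) r := by
  have hP := w.hasDerivAt_P hr
  have hΩ := w.hasDerivAt_Ω (rp := rp) hr
  have hh : HasDerivAt w.h w.ε r :=
    HasDerivAt.congr_deriv (((hasDerivAt_id r).const_mul w.ε).const_add 1) (mul_one _)
  have hn := (hf.mul hφr).sub (hy.mul hφ)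
  have hid := (hasDerivAt_id r).sub_const rp
  have H := ((((((hφv.pow 2).const_mul (-2)).sub ((hf.const_mul 2).mul (hφr.mul hφv))).add
    ((hh.div_const 2).mul ((hf.mul (hφr.pow 2)).sub (hV.mul (hφ.pow 2))))).add
    (((((hP.div_const 2).mul (hn.pow 2)).sub ((hP.const_sub w.k).mul (hφv.pow 2))).sub
      (((hP.const_sub w.k).mul hφv).mul hn)).const_mul w.Λ)).sub (hΩ.mul (hφ.pow 2))).sub
    ((hid.const_mul (2 * w.δ')).mul (hφ.mul hφv))
  refine HasDerivAt.congr_deriv H ?_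
  simp only [energyDeriv, bulk, Pi.mul_apply, Pi.sub_apply, Pi.pow_apply, q, id]
  generalize w.P r = P
  generalize w.Ω rp r = Ω
  generalize w.h r = h
  generalize φ r = φ0 at *
  generalize φr r = p at *
  generalize φv r = d at *
  generalize V r = V0 at *
  generalize V' r = V1
  generalize f' r = f1 at *
  generalize f r = f0 at *
  generalize y r = y0
  norm_num
  field_simp
  -- Up to the cleared denominator, the coefficient of the equation is the total multiplier -2φ_v +
  -- hφ_r + Λ(P(φ_v + n) - kφ_v), where n = fφ_r - yφ. The `Ω` and `δ'` terms use no equation: they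
  -- are exact derivatives.
  linear_combination (16 * r ^ 3 * f0 * (-2 * d + h * p + w.Λ * (P * (f0 * p - y0 * φ0)
    - (w.k - P) * d))) * heq

end Weights


/-! ### Pointwise bounds for the density, the bulk and the current -/

theorem abs_two_mul_le_of_sq (x y : ℝ) : |x * y| ≤ (x ^ 2 + y ^ 2) / 2 := by
  rw [abs_le]
  constructor <;> nlinarith [sq_nonneg (x + y), sq_nonneg (x - y)]

namespace Weights

variable (w : Weights)

theorem P_pos {r : ℝ} (hr : 0 < r) : 0 < w.P r := inv_pos.2 (pow_pos hr _)

theorem P_le {rp r : ℝ} (hrp : 0 < rp) (hr : rp ≤ r) : w.P r ≤ w.P rp := by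
  unfold P
  gcongr

/-- For f > 0 the form is the square (fp - yq)²/f. At the horizon f = y = 0 and every term vanishes,
with y²/0 = 0. -/
theorem gauge_nonneg {f y : ℝ} (hf : 0 ≤ f) (hfy : f = 0 → y = 0) (p q : ℝ) :
    0 ≤ f * p ^ 2 - 2 * y * (p * q) + y ^ 2 / f * q ^ 2 := by
  rcases hf.eq_or_lt with h | h
  · simp [← h, hfy h.symm]
  · have : f * p ^ 2 - 2 * y * (p * q) + y ^ 2 / f * q ^ 2 = (f * p - y * q) ^ 2 / f := by
      field_simp
      ring
    rw [this]
    positivity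

/-- V may decay to zero at infinity (when a = -1), so control of q² comes from the `δ'` term, the
derivative of (r - rp)φ². It costs at most 2δ'r²p², half of what f + h supplies when δ' = 1/(4l²).
-/
theorem energy_ge {f V y : ℝ → ℝ} {rp r l : ℝ} (hl : 0 < l) (hrp : 0 < rp) (hr : rp ≤ r)
    (hf : 0 ≤ f r) (hfy : f r = 0 → y r = 0) (hV : 0 ≤ V r) (hΛ : 0 ≤ w.Λ) (hk : 0 ≤ w.k)
    (hfh : r ^ 2 / l ^ 2 ≤ f r + w.h r) (hδ' : w.δ' = 1 / (4 * l ^ 2)) (p q : ℝ) :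
    1 / (8 * l ^ 2) * (r ^ 2 * p ^ 2 + q ^ 2) ≤ w.energy f V y rp r p q := by
  have hr0 : 0 < r := hrp.trans_le hr
  have h1 := gauge_nonneg hf hfy p q
  have h2 : 0 ≤ w.Λ * w.q r := mul_nonneg hΛ (by unfold Weights.q; linarith [w.P_pos hr0])
  have h3 := mul_nonneg h2 h1
  have h4 : r ^ 2 / l ^ 2 * p ^ 2 ≤ (f r + w.h r) * p ^ 2 := by gcongr
  have h5 : 0 ≤ V r * q ^ 2 := by positivity
  have h6 : -(1 / 2 * q ^ 2 + 2 * (r ^ 2 * p ^ 2)) ≤ 2 * (r - rp) * (p * q) := by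
    have : (r - rp) ^ 2 * p ^ 2 ≤ r ^ 2 * p ^ 2 := by
      gcongr
      linarith
    nlinarith [sq_nonneg (2 * (r - rp) * p + q)]
  have h7 : w.δ' * (q ^ 2 - (1 / 2 * q ^ 2 + 2 * (r ^ 2 * p ^ 2))) ≤
      w.δ' * (q ^ 2 + 2 * (r - rp) * (p * q)) := by
    rw [hδ']
    gcongr
    linarith
  unfold energy
  have h8 : w.δ' * (q ^ 2 - (1 / 2 * q ^ 2 + 2 * (r ^ 2 * p ^ 2))) + r ^ 2 / l ^ 2 * p ^ 2 =
      1 / (8 * l ^ 2) * (4 * r ^ 2 * p ^ 2 + q ^ 2) := by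
    rw [hδ']
    field_simp
    ring
  have h9 : 1 / (8 * l ^ 2) * (r ^ 2 * p ^ 2 + q ^ 2) ≤
      1 / (8 * l ^ 2) * (4 * r ^ 2 * p ^ 2 + q ^ 2) := by
    gcongr
    nlinarith [mul_nonneg (sq_nonneg r) (sq_nonneg p)]
  linarith

theorem energy_le {f V y : ℝ → ℝ} {rp r c z V0 : ℝ} (hrp : 0 < rp) (hr : rp ≤ r)
    (hf0 : 0 ≤ f r) (hfc : f r ≤ c * r ^ 2) (hhc : w.h r ≤ c * r ^ 2)
    (hz : y r ^ 2 / f r ≤ z) (hfy : f r = 0 → y r = 0) (hVV : V r ≤ V0) (hV0 : 0 ≤ V0)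
    (hΛ : 0 ≤ w.Λ) (hk : 0 ≤ w.k) (hkP : w.P r ≤ w.k) (hδ' : 0 ≤ w.δ')
    (p q : ℝ) :
    w.energy f V y rp r p q ≤
      (2 * c + V0 + 2 * w.Λ * w.k * (c + z) + 2 * w.δ') * (r ^ 2 * p ^ 2 + q ^ 2) := by
  have hr0 : 0 < r := hrp.trans_le hr
  have hz0 : 0 ≤ y r ^ 2 / f r := by positivity
  have hc : 0 ≤ c := by
    by_contra h
    push Not at h
    nlinarith [mul_neg_of_neg_of_pos h (pow_pos hr0 2)]
  have h1 : f r * p ^ 2 - 2 * y r * (p * q) + y r ^ 2 / f r * q ^ 2 ≤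
      2 * (f r * p ^ 2) + 2 * (y r ^ 2 / f r * q ^ 2) := by
    -- Positivity at (p, -q) bounds the cross term by the two diagonal terms.
    have := gauge_nonneg hf0 hfy p (-q)
    linarith
  have hX : 0 ≤ r ^ 2 * p ^ 2 := by positivity
  have hY : 0 ≤ q ^ 2 := by positivity
  have hfp : f r * p ^ 2 ≤ c * (r ^ 2 * p ^ 2) := by
    rw [← mul_assoc]; gcongr
  have hhp : w.h r * p ^ 2 ≤ c * (r ^ 2 * p ^ 2) := by
    rw [← mul_assoc]; gcongr
  have hzq : y r ^ 2 / f r * q ^ 2 ≤ z * q ^ 2 := by gcongr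
  have hVq : V r * q ^ 2 ≤ V0 * q ^ 2 := by gcongr
  have hq0 : 0 ≤ w.q r := by unfold Weights.q; linarith [w.P_pos hr0]
  have hqk : w.q r ≤ w.k := by unfold Weights.q; linarith
  have hz0' : 0 ≤ z := hz0.trans hz
  have h2 : w.Λ * w.q r * (f r * p ^ 2 - 2 * y r * (p * q) + y r ^ 2 / f r * q ^ 2) ≤
      w.Λ * w.k * (2 * ((c + z) * (r ^ 2 * p ^ 2 + q ^ 2))) := by
    have hg := gauge_nonneg hf0 hfy p q
    have : f r * p ^ 2 - 2 * y r * (p * q) + y r ^ 2 / f r * q ^ 2 ≤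
        2 * ((c + z) * (r ^ 2 * p ^ 2 + q ^ 2)) := by
      nlinarith [mul_nonneg hc hY, mul_nonneg hz0' hX]
    gcongr
  have h3 : q ^ 2 + 2 * (r - rp) * (p * q) ≤ 2 * (r ^ 2 * p ^ 2 + q ^ 2) := by
    have : (r - rp) ^ 2 * p ^ 2 ≤ r ^ 2 * p ^ 2 := by
      gcongr
      linarith
    nlinarith [sq_nonneg ((r - rp) * p - q)]
  have h4 : w.δ' * (q ^ 2 + 2 * (r - rp) * (p * q)) ≤ w.δ' * (2 * (r ^ 2 * p ^ 2 + q ^ 2)) := by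
    gcongr
  unfold energy
  nlinarith [mul_nonneg hV0 hX, mul_nonneg hc hY]

/-- Young's inequality for the cross term; this is what fixes how fast P = r^(-b) must decay
relative to the bound m on ry/f. -/
theorem static_form_ge {b m g n L : ℝ} (hg : |g| ≤ m) (hb : 2 * m + 4 ≤ b) :
    n ^ 2 ≤ b / 4 * n ^ 2 + b * L ^ 2 + 2 * g * (n * L) := by
  have h1 : |2 * g * (n * L)| ≤ m * (n ^ 2 / 2 + 2 * L ^ 2) := by
    have := abs_two_mul_le_of_sq n (2 * L)
    rw [show 2 * g * (n * L) = g * (n * (2 * L)) by ring, abs_mul]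
    exact mul_le_mul hg (this.trans_eq (by ring)) (abs_nonneg _) ((abs_nonneg _).trans hg)
  have h2 := neg_le_of_abs_le h1
  nlinarith [mul_nonneg (sub_nonneg.2 hb) (add_nonneg (sq_nonneg n) (mul_nonneg (by norm_num :
    (0 : ℝ) ≤ 4) (sq_nonneg L))), sq_nonneg L, sq_nonneg n]

/-- The 2C/r³ part of Ω' repays the negative potential term. The only other indefinite contribution
is 2Ωqp, absorbed by the redshift term for r ≥ R and by the static term for r ≤ R. The redshift term
is present twice: one copy is kept in the conclusion, the other is spent. -/
theorem bulk_ge {f V y f' V' : ℝ → ℝ} {rp r l m R C₂ : ℝ} (hr : 0 < r) (hf : 0 < f r)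
    (hε : w.ε * (r ^ 2 / l ^ 2) ≤ w.h r * f' r - w.ε * f r)
    (hC : -(2 * w.C) / r ^ 3 ≤ w.ε * V r + w.h r * V' r) (hC0 : 0 ≤ w.C)
    (hm : |y r / f r * r| ≤ m) (hy : 0 ≤ y r) (hb : 2 * m + 4 ≤ w.b) (hδ : 0 < w.δ)
    (hδε : 8 * w.δ ≤ w.ε / (4 * l ^ 2))
    (hΛ : 0 ≤ w.Λ) (hΩ0 : 0 ≤ w.Ω rp r) (hΩR : R ≤ r → w.Ω rp r ≤ 2 * w.δ * r)
    (hΩf : w.Ω rp r ≤ C₂ * f r) (hΛR : r ≤ R → 2 * C₂ ^ 2 / w.δ ≤ w.Λ * (w.P r / r))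
    (d p q : ℝ) :
    w.ε / (4 * l ^ 2) * (r ^ 2 * p ^ 2) + w.δ / 2 * q ^ 2 ≤ w.bulk f V y f' V' rp r d p q := by
  have hP := w.P_pos hr
  have hst := static_form_ge (n := f r * p - y r * q)
    (L := d + (f r * p - y r * q) / 2) hm hb
  have h1 := mul_le_mul_of_nonneg_left hst (mul_nonneg hΛ (div_pos hP hr).le)
  have h2 : w.ε * (r ^ 2 / l ^ 2) / 2 * p ^ 2 ≤ (w.h r * f' r - w.ε * f r) / 2 * p ^ 2 := by
    gcongr
  have h3 : -(w.C / r ^ 3) * q ^ 2 ≤ (w.ε * V r + w.h r * V' r) / 2 * q ^ 2 := by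
    gcongr
    have : -(2 * w.C) / r ^ 3 = 2 * -(w.C / r ^ 3) := by ring
    linarith
  have h4 : 0 ≤ w.C / r ^ 3 * q ^ 2 := by positivity
  have h5 : w.ε * (r ^ 2 / l ^ 2) / 2 * p ^ 2 = 2 * (w.ε / (4 * l ^ 2) * (r ^ 2 * p ^ 2)) := by
    ring
  have h6 : 0 ≤ w.ε / (4 * l ^ 2) * (r ^ 2 * p ^ 2) :=
    mul_nonneg (by linarith) (by positivity)
  have h7 : (w.δ + 2 * w.C / r ^ 3) * q ^ 2 = w.δ * q ^ 2 + 2 * (w.C / r ^ 3 * q ^ 2) := by ring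
  unfold bulk
  suffices h : -(w.δ / 2 * q ^ 2) - w.ε / (4 * l ^ 2) * (r ^ 2 * p ^ 2) -
      w.Λ * (w.P r / r) * (f r * p - y r * q) ^ 2 ≤ 2 * w.Ω rp r * (q * p) by linarith
  rcases le_total R r with h | h
  · have h8 : 0 ≤ w.Λ * (w.P r / r) * (f r * p - y r * q) ^ 2 := by positivity
    have h9 : w.Ω rp r ^ 2 * p ^ 2 ≤ (2 * w.δ * r) ^ 2 * p ^ 2 := by
      gcongr
      exact hΩR h
    have h10 : 8 * w.δ * (r ^ 2 * p ^ 2) ≤ w.ε / (4 * l ^ 2) * (r ^ 2 * p ^ 2) := by gcongr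
    have h11 : 0 ≤ (w.δ * q + 2 * (w.Ω rp r * p)) ^ 2 / (2 * w.δ) := by positivity
    have h12 : (w.δ * q + 2 * (w.Ω rp r * p)) ^ 2 / (2 * w.δ) = w.δ / 2 * q ^ 2 +
        2 * w.Ω rp r * (q * p) + 2 * (w.Ω rp r ^ 2 * p ^ 2) / w.δ := by
      field_simp
      ring
    have h13 : 2 * (w.Ω rp r ^ 2 * p ^ 2) / w.δ ≤ 8 * w.δ * (r ^ 2 * p ^ 2) := by
      rw [div_le_iff₀ hδ]
      nlinarith
    linarith
  -- With Ω = sf the cross term becomes 2sqn + 2syq². The last summand is nonnegative because y ≥ 0,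
  -- and sqn is absorbed by δq² and the large multiple of n².
  · set n := f r * p - y r * q with hn
    have h8 : 2 * C₂ ^ 2 / w.δ * n ^ 2 ≤ w.Λ * (w.P r / r) * n ^ 2 := by
      gcongr
      exact hΛR h
    set s := w.Ω rp r / f r with hs
    have hs0 : 0 ≤ s := by positivity
    have hsC : s ≤ C₂ := by rwa [hs, div_le_iff₀ hf]
    have hsf : w.Ω rp r = s * f r := by rw [hs]; field_simp
    have h9 : 2 * w.Ω rp r * (q * p) = 2 * (s * q * n) + 2 * (s * y r * q ^ 2) := by
      rw [hsf, hn]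
      ring
    have h10 : 0 ≤ s * y r * q ^ 2 := by positivity
    have h11 : s ^ 2 * n ^ 2 ≤ C₂ ^ 2 * n ^ 2 := by gcongr
    have h12 : 0 ≤ (w.δ * q + 2 * (s * n)) ^ 2 / (2 * w.δ) := by positivity
    have h13 : (w.δ * q + 2 * (s * n)) ^ 2 / (2 * w.δ) = w.δ / 2 * q ^ 2 +
        2 * (s * q * n) + 2 * (s ^ 2 * n ^ 2) / w.δ := by
      field_simp
      ring
    have h14 : 2 * (s ^ 2 * n ^ 2) / w.δ ≤ 2 * C₂ ^ 2 / w.δ * n ^ 2 := by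
      rw [div_mul_eq_mul_div]
      gcongr ?_ / _
      linarith
    linarith

/-- The term of order r³p² is hfp²/2, which enters the current with the favourable sign and is
dropped, as is the square multiplied by P. What is left grows only like r times the integrable
quantities, just what the cutoff 1 - r/N can tolerate. -/
theorem neg_current_le {f V y : ℝ → ℝ} {rp r c V0 c₃ : ℝ} (hrp : 0 < rp) (hr : rp ≤ r)
    (hf0 : 0 ≤ f r) (hfc : f r ≤ c * r ^ 2) (hh0 : 0 ≤ w.h r) (hhc : w.h r ≤ c * r)
    (hV0 : 0 ≤ V r) (hVV : V r ≤ V0) (hy0 : 0 ≤ y r) (hy : y r ≤ V0 * r)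
    (hΛ : 0 ≤ w.Λ) (hkP : w.P r ≤ w.k) (hδ' : 0 ≤ w.δ')
    (hΩ : w.Ω rp r ≤ c₃ * r) (hΩ0 : 0 ≤ w.Ω rp r) (d p q : ℝ) :
    -w.current f V y rp r d p q ≤ (2 / rp + c + c * V0 + w.Λ * w.k * (1 / rp + c + V0) +
      c₃ + w.δ') * r * (d ^ 2 + (r ^ 2 * p ^ 2 + q ^ 2)) := by
  have hr0 : 0 < r := hrp.trans_le hr
  have hP := w.P_pos hr0
  have hc : 0 ≤ c := by
    by_contra h
    push Not at h
    nlinarith [mul_neg_of_neg_of_pos h hr0]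
  have hV00 : 0 ≤ V0 := hV0.trans hVV
  have hk : 0 ≤ w.k := hP.le.trans hkP
  have hX : 0 ≤ r ^ 2 * p ^ 2 := by positivity
  have hY : 0 ≤ q ^ 2 := by positivity
  have hD : 0 ≤ d ^ 2 := by positivity
  set S := d ^ 2 + (r ^ 2 * p ^ 2 + q ^ 2) with hS
  have hS0 : 0 ≤ S := by positivity
  have hd : d ^ 2 ≤ 1 / rp * r * S := by
    have : 1 ≤ 1 / rp * r := by rw [one_div_mul_eq_div, one_le_div hrp]; exact hr
    nlinarith [mul_le_mul_of_nonneg_right this hS0]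
  have hfpd : |f r * (p * d)| ≤ c * r * S / 2 := by
    have h := abs_two_mul_le_of_sq (r * p) d
    have h' : |f r * (p * d)| = f r / r * |r * p * d| := by
      rw [show f r * (p * d) = f r / r * (r * p * d) by field_simp, abs_mul,
        abs_of_nonneg (by positivity)]
    rw [h']
    have h1 : f r / r ≤ c * r := by rw [div_le_iff₀ hr0]; nlinarith
    have h2 : |r * p * d| ≤ S / 2 := by nlinarith
    calc f r / r * |r * p * d| ≤ c * r * (S / 2) := by gcongr
      _ = _ := by ring
  have hyqd : |y r * (q * d)| ≤ V0 * r * S / 2 := by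
    have h := abs_two_mul_le_of_sq q d
    rw [abs_mul, abs_of_nonneg hy0]
    have h2 : |q * d| ≤ S / 2 := by nlinarith
    calc y r * |q * d| ≤ V0 * r * (S / 2) := by gcongr
      _ = _ := by ring
  have hqd : |(r - rp) * (q * d)| ≤ r * S / 2 := by
    have h := abs_two_mul_le_of_sq q d
    rw [abs_mul, abs_of_nonneg (sub_nonneg.2 hr)]
    have h2 : |q * d| ≤ S / 2 := by nlinarith
    calc (r - rp) * |q * d| ≤ r * (S / 2) := by gcongr; linarith
      _ = _ := by ring
  have hhV : w.h r * (V r * q ^ 2) ≤ c * V0 * r * S := by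
    calc w.h r * (V r * q ^ 2) ≤ c * r * (V0 * S) := by
          gcongr
          linarith
      _ = _ := by ring
  have hhp : 0 ≤ w.h r / 2 * (f r * p ^ 2) := by positivity
  have hqS : q ^ 2 ≤ S := by linarith
  have hΩq : w.Ω rp r * q ^ 2 ≤ c₃ * r * S := mul_le_mul hΩ hqS hY (hΩ0.trans hΩ)
  have hPn : 0 ≤ w.P r / 2 * (f r * p - y r * q) ^ 2 := by positivity
  have hkP0 : 0 ≤ w.k - w.P r := sub_nonneg.2 hkP
  have hkk : w.k - w.P r ≤ w.k := by linarith
  have hkin : (w.k - w.P r) * (d ^ 2 + d * (f r * p - y r * q)) ≤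
      w.k * ((1 / rp + c + V0) * r * S) := by
    have h1 : d ^ 2 + d * (f r * p - y r * q) ≤ (1 / rp + c + V0) * r * S := by
      have h2 := le_of_abs_le hfpd
      have h3 := neg_le_of_abs_le hyqd
      have h4 : 0 ≤ c * r * S := by positivity
      have h5 : 0 ≤ V0 * r * S := by positivity
      linarith
    calc (w.k - w.P r) * (d ^ 2 + d * (f r * p - y r * q))
        ≤ (w.k - w.P r) * ((1 / rp + c + V0) * r * S) := by gcongr
      _ ≤ _ := by gcongr
  have hkin' := mul_le_mul_of_nonneg_left hkin hΛ
  have hΛP := mul_nonneg hΛ hPn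
  have hδd : w.δ' * ((r - rp) * (q * d)) ≤ w.δ' * (r * S / 2) := by
    gcongr
    exact le_of_abs_le hqd
  have h2 := le_of_abs_le hfpd
  have h9 : 0 ≤ c * V0 * r * S := by positivity
  clear_value S
  unfold current
  linear_combination 2 * hd + 2 * h2 + 1 / 2 * hhV + hkin' + hΛP + hΩq + 2 * hδd + hhp + 1 / 2 * h9

end Weights

/-! ### Construction of the energy current on Schwarzschild-AdS -/

/-- A quadratic energy current for the equation `2 φ_vr + (f φ_r)_r - V φ = 0` satisfied by
`φ = r ψ`: the energy density `A φ_r² + B φ_r φ + Γ φ²` is comparable to `r² φ_r² + φ²`, and its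
divergence together with that of the radial current `J` controls it. -/
structure EnergyCurrent (M l a rp : ℝ) where
  (A B Γ : ℝ → ℝ)
  J : ℝ → ℝ → ℝ → ℝ → ℝ
  (c₁ c₂ c₃ c₄ : ℝ)
  c₁_pos : 0 < c₁
  c₂_pos : 0 < c₂
  c₃_pos : 0 < c₃
  c₄_pos : 0 < c₄
  continuousOn_A : ContinuousOn A (Ici rp)
  continuousOn_B : ContinuousOn B (Ici rp)
  continuousOn_Γ : ContinuousOn Γ (Ici rp)
  continuousOn_J : ContinuousOn (fun x : ℝ × ℝ × ℝ × ℝ => J x.1 x.2.1 x.2.2.1 x.2.2.2)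
    (Ici rp ×ˢ univ)
  density_ge : ∀ r, rp ≤ r → ∀ p q,
    c₁ * (r ^ 2 * p ^ 2 + q ^ 2) ≤ A r * p ^ 2 + B r * (p * q) + Γ r * q ^ 2
  density_le : ∀ r, rp ≤ r → ∀ p q,
    A r * p ^ 2 + B r * (p * q) + Γ r * q ^ 2 ≤ c₂ * (r ^ 2 * p ^ 2 + q ^ 2)
  neg_J_le : ∀ r, rp ≤ r → ∀ d p q, -J r d p q ≤ c₃ * r * (d ^ 2 + (r ^ 2 * p ^ 2 + q ^ 2))
  J_horizon : ∀ d p q, J rp d p q ≤ 0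
  divergence : ∀ r, rp < r → ∀ (φ φr φv : ℝ → ℝ) (prr pvr : ℝ), HasDerivAt φ (φr r) r →
    HasDerivAt φr prr r → HasDerivAt φv pvr r →
    2 * pvr + lapse M l r * prr + (2 * M / r ^ 2 + 2 * r / l ^ 2) * φr r
      - potential M l a r * φ r = 0 →
    ∃ J', HasDerivAt (fun s => J s (φv s) (φr s) (φ s)) J' r ∧
      2 * A r * (φr r * pvr) + B r * (pvr * φ r + φr r * φv r) + 2 * Γ r * (φ r * φv r) + J' ≤
        -c₄ * (A r * φr r ^ 2 + B r * (φr r * φ r) + Γ r * φ r ^ 2)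

section

variable {M l a rp : ℝ}

theorem continuousOn_lapse (hrp : 0 < rp) : ContinuousOn (lapse M l) (Ici rp) := fun _ hr =>
  (hasDerivAt_lapse (hrp.trans_le hr).ne').continuousAt.continuousWithinAt

theorem continuousOn_potential (hrp : 0 < rp) : ContinuousOn (potential M l a) (Ici rp) :=
  fun _ hr => (hasDerivAt_potential (hrp.trans_le hr).ne').continuousAt.continuousWithinAt

/-- The quadratic growth of f makes (1 + εr)f' exceed εf by a further εr²/l² at infinity, while
positivity of f' at the horizon supplies the redshift. Expanding shows that every remaining term is
nonnegative. -/
theorem redshift_ge (hM : 0 < M) (hl : 0 < l) (hrp : 0 < rp) {r : ℝ} (hr : rp ≤ r) :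
    rp / l ^ 2 * (r ^ 2 / l ^ 2) ≤ (1 + rp / l ^ 2 * r) * (2 * M / r ^ 2 + 2 * r / l ^ 2)
      - rp / l ^ 2 * lapse M l r := by
  have hr0 : 0 < r := hrp.trans_le hr
  have h1 : (1 + rp / l ^ 2 * r) * (2 * M / r ^ 2 + 2 * r / l ^ 2) - rp / l ^ 2 * lapse M l r =
      rp / l ^ 2 * (r ^ 2 / l ^ 2) + (2 * M / r ^ 2 + rp / l ^ 2 * (4 * M / r)) +
        (2 * r - rp) / l ^ 2 := by
    unfold lapse
    field_simp
    ring
  have h2 : 0 ≤ 2 * M / r ^ 2 + rp / l ^ 2 * (4 * M / r) := by positivity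
  have h3 : 0 ≤ (2 * r - rp) / l ^ 2 := div_nonneg (by linarith) (by positivity)
  linarith

/-- The constant part of the potential contributes with a good sign since a ≥ -1; only the mass
terms are lost, and they are O(r⁻³). -/
theorem weighted_potential_ge (hM : 0 < M) (hl : 0 < l) (ha : -1 ≤ a) (hrp : 0 < rp)
    {r : ℝ} (hr : rp ≤ r) :
    -(2 * (2 * M * (rp / l ^ 2) + 3 * M / rp)) / r ^ 3 ≤
      rp / l ^ 2 * potential M l a r + (1 + rp / l ^ 2 * r) * (-6 * M / r ^ 4) := by
  have hr0 : 0 < r := hrp.trans_le hr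
  have ha' : 0 ≤ 1 + a := by linarith
  have h1 : rp / l ^ 2 * potential M l a r + (1 + rp / l ^ 2 * r) * (-6 * M / r ^ 4) =
      rp / l ^ 2 * (2 * (1 + a) / l ^ 2) - (4 * M * (rp / l ^ 2) + 6 * M / r) / r ^ 3 := by
    unfold potential
    field_simp
    ring
  have h2 : (4 * M * (rp / l ^ 2) + 6 * M / r) / r ^ 3 ≤
      (4 * M * (rp / l ^ 2) + 6 * M / rp) / r ^ 3 := by
    gcongr
  have h3 : 0 ≤ rp / l ^ 2 * (2 * (1 + a) / l ^ 2) := by positivity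
  rw [h1, show -(2 * (2 * M * (rp / l ^ 2) + 3 * M / rp)) / r ^ 3 =
    -((4 * M * (rp / l ^ 2) + 6 * M / rp) / r ^ 3) by ring]
  linarith

theorem one_div_sq_sub_nonneg (hrp : 0 < rp) {r : ℝ} (hr : rp ≤ r) :
    0 ≤ 1 / rp ^ 2 - 1 / r ^ 2 := by
  rw [sub_nonneg]
  gcongr

theorem one_div_sq_sub_le (hrp : 0 < rp) {r : ℝ} (hr : rp ≤ r) :
    1 / rp ^ 2 - 1 / r ^ 2 ≤ 2 / rp ^ 3 * (r - rp) := by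
  have hr0 : 0 < r := hrp.trans_le hr
  rw [div_sub_div _ _ (by positivity) (by positivity), div_mul_eq_mul_div,
    div_le_div_iff₀ (by positivity) (by positivity)]
  have h1 : 0 ≤ r - rp := sub_nonneg.2 hr
  have h2 : (1 * r ^ 2 - rp ^ 2 * 1) * rp ^ 3 = (r - rp) * rp ^ 2 * ((r + rp) * rp) := by ring
  have h3 : 2 * (r - rp) * (rp ^ 2 * r ^ 2) = (r - rp) * rp ^ 2 * (2 * r ^ 2) := by ring
  rw [h2, h3]
  refine mul_le_mul_of_nonneg_left ?_ (by positivity)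
  nlinarith

theorem Weights.continuousOn_current (w : Weights) {f V y : ℝ → ℝ} {S : Set (ℝ × ℝ × ℝ × ℝ)}
    (hf : ContinuousOn (fun x : ℝ × ℝ × ℝ × ℝ => f x.1) S)
    (hV : ContinuousOn (fun x : ℝ × ℝ × ℝ × ℝ => V x.1) S)
    (hy : ContinuousOn (fun x : ℝ × ℝ × ℝ × ℝ => y x.1) S)
    (hP : ContinuousOn (fun x : ℝ × ℝ × ℝ × ℝ => w.P x.1) S)
    (hΩ : ContinuousOn (fun x : ℝ × ℝ × ℝ × ℝ => w.Ω rp x.1) S)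
    (hh : ContinuousOn (fun x : ℝ × ℝ × ℝ × ℝ => w.h x.1) S) :
    ContinuousOn (fun x : ℝ × ℝ × ℝ × ℝ => w.current f V y rp x.1 x.2.1 x.2.2.1 x.2.2.2) S := by
  have key : ∀ F V Y P Ω H : ℝ × ℝ × ℝ × ℝ → ℝ, ContinuousOn F S → ContinuousOn V S →
      ContinuousOn Y S → ContinuousOn P S → ContinuousOn Ω S → ContinuousOn H S →
      ContinuousOn (fun x : ℝ × ℝ × ℝ × ℝ => -2 * x.2.1 ^ 2 - 2 * F x * (x.2.2.1 * x.2.1)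
        + H x / 2 * (F x * x.2.2.1 ^ 2 - V x * x.2.2.2 ^ 2)
        + w.Λ * (P x / 2 * (F x * x.2.2.1 - Y x * x.2.2.2) ^ 2 - (w.k - P x) * x.2.1 ^ 2
          - (w.k - P x) * x.2.1 * (F x * x.2.2.1 - Y x * x.2.2.2))
        - Ω x * x.2.2.2 ^ 2 - 2 * w.δ' * (x.1 - rp) * (x.2.2.2 * x.2.1)) S := by
    intros
    fun_prop
  exact key _ _ _ _ _ _ hf hV hy hP hΩ hh

set_option maxHeartbeats 1000000 in
theorem nonempty_energyCurrent (hM : 0 < M) (hl : 0 < l) (ha : -1 ≤ a)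
    (hrp : 0 < rp) (hhor : lapse M l rp = 0) : Nonempty (EnergyCurrent M l a rp) := by
  obtain ⟨y, hyc, hy0, hyd, hyb⟩ := exists_static_riccati hM hl ha hrp hhor
  set V0 := potential M l a rp with hV0
  have hV00 : 0 ≤ V0 := potential_nonneg hM ha hrp
  set f := lapse M l with hf
  set V := potential M l a with hV
  have hfnn : ∀ r, rp ≤ r → 0 ≤ f r := fun r hr => lapse_nonneg hl hrp hhor hr
  have hfge : ∀ r, rp ≤ r → (r - rp) * (r / l ^ 2) ≤ f r := fun r hr =>
    mul_le_lapse hl hrp hhor hr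
  have hfy : ∀ r, rp ≤ r → f r = 0 → y r = 0 := by
    intro r hr h
    rcases hr.eq_or_lt with rfl | h'
    · exact hy0
    · exact absurd h (lapse_pos hl hrp hhor h').ne'
  set m := V0 * l ^ 2 with hm
  set ε := rp / l ^ 2 with hε
  have hεpos : 0 < ε := by positivity
  set C := 2 * M * ε + 3 * M / rp with hC
  have hCpos : 0 < C := by positivity
  set δ := ε / (32 * l ^ 2) with hδ
  have hδpos : 0 < δ := by positivity
  set C₂ := (δ + C * (2 / rp ^ 3)) / ε with hC₂
  have hC₂pos : 0 < C₂ := by positivity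
  set R := C / (δ * rp ^ 2) with hR
  have hRpos : 0 < R := by positivity
  obtain ⟨b, hb⟩ := exists_nat_ge (2 * m + 4)
  -- The factor R^(b+1) compensates P/r = r^(-(b+1)) on r ≤ R. The value k = P(rp) is the maximum of
  -- P on the exterior, so k - P ≥ 0 throughout, with equality at the horizon.
  set w : Weights := ⟨ε, δ, C, 2 * C₂ ^ 2 / δ * R ^ (b + 1), (rp ^ b)⁻¹, 1 / (4 * l ^ 2), b⟩
    with hw
  have hΛ : 0 ≤ w.Λ := by simp only [hw]; positivity
  have hk : 0 ≤ w.k := by simp only [hw]; positivity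
  have hkP : ∀ r, rp ≤ r → w.P r ≤ w.k := fun r hr => w.P_le hrp hr
  have hδ' : 0 ≤ w.δ' := by simp only [hw]; positivity
  have hyz : ∀ r, rp ≤ r → y r / f r * r ≤ m := by
    intro r hr
    have hr0 : 0 < r := hrp.trans_le hr
    rw [div_mul_eq_mul_div]
    refine div_le_of_le_mul₀ (hfnn r hr) (by positivity) ?_
    calc y r * r ≤ V0 * (r - rp) * r := by gcongr; exact (hyb r hr).2
      _ = m * ((r - rp) * (r / l ^ 2)) := by rw [hm]; field_simp
      _ ≤ m * f r := by gcongr; exact hfge r hr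
  have hym : ∀ r, rp ≤ r → y r ≤ V0 * r := fun r hr => (hyb r hr).2.trans (by gcongr; linarith)
  have hz : ∀ r, rp ≤ r → y r ^ 2 / f r ≤ V0 * m := by
    intro r hr
    have hr0 : 0 < r := hrp.trans_le hr
    have h1 : 0 ≤ y r / f r := div_nonneg (hyb r hr).1 (hfnn r hr)
    calc y r ^ 2 / f r = y r / f r * y r := by ring
      _ ≤ y r / f r * (V0 * r) := by gcongr; exact hym r hr
      _ = V0 * (y r / f r * r) := by ring
      _ ≤ V0 * m := by gcongr; exact hyz r hr
  have hΩ0 : ∀ r, rp ≤ r → 0 ≤ w.Ω rp r := fun r hr => add_nonneg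
    (mul_nonneg hδpos.le (sub_nonneg.2 hr)) (mul_nonneg hCpos.le (one_div_sq_sub_nonneg hrp hr))
  have hΩ1 : ∀ r, rp ≤ r → w.Ω rp r ≤ (δ + C * (2 / rp ^ 3)) * (r - rp) := by
    intro r hr
    have := mul_le_mul_of_nonneg_left (one_div_sq_sub_le hrp hr) hCpos.le
    simp only [Weights.Ω, hw]
    linarith
  have hfc : ∀ r, rp ≤ r → f r ≤ (1 / rp ^ 2 + 1 / l ^ 2) * r ^ 2 := fun r hr =>
    lapse_le hM hrp hr
  have hh : ∀ r, rp ≤ r → w.h r ≤ (1 / rp + ε) * r := by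
    intro r hr
    have : 1 ≤ 1 / rp * r := by rw [one_div_mul_eq_div, one_le_div hrp]; exact hr
    simp only [Weights.h, hw]
    linarith
  have hh2 : ∀ r, rp ≤ r → w.h r ≤ (1 / rp ^ 2 + ε / rp) * r ^ 2 := by
    intro r hr
    have h1 : 1 ≤ r / rp := by rw [one_le_div hrp]; exact hr
    have hr0 : 0 < r := hrp.trans_le hr
    calc w.h r ≤ (1 / rp + ε) * r := hh r hr
      _ ≤ (1 / rp + ε) * r * (r / rp) := le_mul_of_one_le_right (by positivity) h1
      _ = _ := by field_simp
  have hVV : ∀ r, rp ≤ r → V r ≤ V0 := fun r hr => potential_le hM hrp hr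
  have hVn : ∀ r, rp ≤ r → 0 ≤ V r := fun r hr => potential_nonneg hM ha (hrp.trans_le hr)
  have hh0 : ∀ r, rp ≤ r → 0 ≤ w.h r := by
    intro r hr
    have hr0 : 0 < r := hrp.trans_le hr
    simp only [Weights.h, hw]
    positivity
  set cc := 1 / rp ^ 2 + 1 / l ^ 2 + (1 / rp ^ 2 + ε / rp) + (1 / rp + ε) with hcc
  have hccpos : 0 < cc := by positivity
  set c₂ := 2 * cc + V0 + 2 * w.Λ * w.k * (cc + V0 * m) + 2 * w.δ' with hc₂
  have hc₂pos : 0 < c₂ := by positivity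
  have hfcc : ∀ r, rp ≤ r → f r ≤ cc * r ^ 2 := fun r hr => (hfc r hr).trans (by
    gcongr
    rw [hcc, add_assoc]
    exact le_add_of_nonneg_right (by positivity))
  have hlo : ∀ r, rp ≤ r → ∀ p q,
      1 / (8 * l ^ 2) * (r ^ 2 * p ^ 2 + q ^ 2) ≤ w.energy f V y rp r p q := by
    intro r hr p q
    refine w.energy_ge hl hrp hr (hfnn r hr) (hfy r hr) (hVn r hr) hΛ hk ?_ rfl p q
    have h1 := sq_le_lapse (M := M) hl hrp hhor hr
    have h2 : rp ^ 2 / l ^ 2 ≤ ε * r := by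
      rw [hε, div_mul_eq_mul_div, sq]
      gcongr
    rw [sub_div] at h1
    simp only [Weights.h, hw]
    linarith
  have hup : ∀ r, rp ≤ r → ∀ p q,
      w.energy f V y rp r p q ≤ c₂ * (r ^ 2 * p ^ 2 + q ^ 2) := by
    intro r hr p q
    refine w.energy_le hrp hr (hfnn r hr) (hfcc r hr) ((hh2 r hr).trans ?_) (hz r hr) (hfy r hr)
      (hVV r hr) hV00 hΛ hk (hkP r hr) hδ' p q
    gcongr
    rw [hcc]
    have : 0 < 1 / rp ^ 2 + 1 / l ^ 2 := by positivity
    have : 0 < 1 / rp + ε := by positivity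
    linarith
  have hbulk : ∀ r, rp < r → ∀ d p q, w.ε / (4 * l ^ 2) * (r ^ 2 * p ^ 2) + w.δ / 2 * q ^ 2 ≤
      w.bulk f V y (fun r => 2 * M / r ^ 2 + 2 * r / l ^ 2) (fun r => -6 * M / r ^ 4)
        rp r d p q := by
    intro r hr d p q
    have hr0 : 0 < r := hrp.trans hr
    refine w.bulk_ge (m := m) (R := R) (C₂ := C₂) hr0 (lapse_pos hl hrp hhor hr)
      (redshift_ge hM hl hrp hr.le)
      (weighted_potential_ge hM hl ha hrp hr.le) hCpos.le ?_ (hyb r hr.le).1 hb hδpos ?_ hΛ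
      (hΩ0 r hr.le) ?_ ?_ ?_ d p q
    · rw [abs_of_nonneg (mul_nonneg (div_nonneg (hyb r hr.le).1 (hfnn r hr.le)) hr0.le)]
      exact hyz r hr.le
    · simp only [hw, hδ]
      exact le_of_eq (by ring)
    · intro hRr
      have h1 : C * (1 / rp ^ 2 - 1 / r ^ 2) ≤ C * (1 / rp ^ 2) := by
        gcongr
        have : 0 < 1 / r ^ 2 := by positivity
        linarith
      have h2 : C * (1 / rp ^ 2) ≤ δ * r := by
        calc C * (1 / rp ^ 2) = δ * R := by rw [hR]; field_simp
          _ ≤ δ * r := by gcongr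
      have h3 : 0 < δ * rp := by positivity
      simp only [Weights.Ω, hw]
      linarith
    · refine (hΩ1 r hr.le).trans ?_
      have h1 : ε * (r - rp) ≤ f r := by
        refine le_trans ?_ (hfge r hr.le)
        rw [mul_comm, hε]
        have := sub_nonneg.2 hr.le
        gcongr
      calc (δ + C * (2 / rp ^ 3)) * (r - rp) = C₂ * (ε * (r - rp)) := by rw [hC₂]; field_simp
        _ ≤ C₂ * f r := by gcongr
    · intro hrR
      have h1 : w.P r / r = (r ^ (b + 1))⁻¹ := by
        simp only [Weights.P, hw]
        rw [pow_succ, mul_inv, div_eq_mul_inv]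
      rw [h1]
      simp only [hw]
      rw [mul_assoc]
      refine le_mul_of_one_le_right (by positivity) ?_
      rw [← div_eq_mul_inv, one_le_div (by positivity)]
      gcongr
  set cb := min (ε / (4 * l ^ 2)) (δ / 2) with hcb
  have hcbpos : 0 < cb := lt_min (by positivity) (by positivity)
  -- At the horizon this is formally 0/0; boundedness of y/f squeezes it by a multiple of y, which
  -- tends to 0.
  have hyc2 : ContinuousOn (fun r => y r ^ 2 / f r) (Ici rp) := by
    intro r hr
    rcases (mem_Ici.1 hr).eq_or_lt with rfl | hlt
    · have hlim : ContinuousWithinAt (fun s => m / rp * y s) (Ici rp) rp :=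
        (hyc rp hr).const_mul _
      have hlim' : Filter.Tendsto (fun s => m / rp * y s) (nhdsWithin rp (Ici rp)) (nhds 0) := by
        have := hlim.tendsto
        rwa [hy0, mul_zero] at this
      have hval : y rp ^ 2 / f rp = 0 := by simp [hy0]
      change Filter.Tendsto _ _ (nhds (y rp ^ 2 / f rp))
      rw [hval]
      refine squeeze_zero' ?_ ?_ hlim'
      · filter_upwards [self_mem_nhdsWithin] with z hz' using
          div_nonneg (sq_nonneg _) (hfnn z hz')
      · filter_upwards [self_mem_nhdsWithin] with z hz'
        have h1 : 0 ≤ y z / f z := div_nonneg (hyb z hz').1 (hfnn z hz')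
        have h2 : y z / f z ≤ m / rp := by
          rw [le_div_iff₀ hrp]
          exact (mul_le_mul_of_nonneg_left hz' h1).trans (hyz z hz')
        calc y z ^ 2 / f z = y z / f z * y z := by ring
          _ ≤ m / rp * y z := mul_le_mul_of_nonneg_right h2 (hyb z hz').1
    · exact ((hyc r hr).pow 2).div (continuousOn_lapse hrp r hr) (lapse_pos hl hrp hhor hlt).ne'
  have hfcont : ContinuousOn f (Ici rp) := continuousOn_lapse hrp
  have hVcont : ContinuousOn V (Ici rp) := continuousOn_potential hrp
  have hPcont : ContinuousOn w.P (Ici rp) := fun r hr =>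
    (w.hasDerivAt_P (hrp.trans_le hr).ne').continuousAt.continuousWithinAt
  have hΩcont : ContinuousOn (w.Ω rp) (Ici rp) := fun r hr =>
    (w.hasDerivAt_Ω (hrp.trans_le hr).ne').continuousAt.continuousWithinAt
  have hhcont : ContinuousOn w.h (Ici rp) := by
    unfold Weights.h
    fun_prop
  have hqcont : ContinuousOn w.q (Ici rp) := (continuousOn_const.add hPcont).div_const 2
  have hen : ∀ r p q, (f r + w.h r + w.Λ * w.q r * f r) * p ^ 2
      + (2 * (w.δ' * (r - rp)) - 2 * (w.Λ * w.q r * y r)) * (p * q)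
      + (V r + w.Λ * w.q r * (y r ^ 2 / f r) + w.δ') * q ^ 2 = w.energy f V y rp r p q := by
    intro r p q
    unfold Weights.energy
    ring
  refine ⟨⟨fun r => f r + w.h r + w.Λ * w.q r * f r,
    fun r => 2 * (w.δ' * (r - rp)) - 2 * (w.Λ * w.q r * y r),
    fun r => V r + w.Λ * w.q r * (y r ^ 2 / f r) + w.δ',
    w.current f V y rp, 1 / (8 * l ^ 2), c₂,
    2 / rp + cc + cc * V0 + w.Λ * w.k * (1 / rp + cc + V0) + (δ + C * (2 / rp ^ 3)) + w.δ',
    cb / c₂, by positivity, hc₂pos, by positivity, by positivity, by fun_prop, by fun_prop,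
    by fun_prop, ?_, fun r hr p q => by rw [hen]; exact hlo r hr p q,
    fun r hr p q => by rw [hen]; exact hup r hr p q, ?_, ?_, ?_⟩⟩
  · have hfst : ∀ {g : ℝ → ℝ}, ContinuousOn g (Ici rp) →
        ContinuousOn (fun x : ℝ × ℝ × ℝ × ℝ => g x.1) (Ici rp ×ˢ univ) := fun hg =>
      hg.comp continuous_fst.continuousOn fun x hx => hx.1
    have h1 := hfst hfcont
    have h2 := hfst hVcont
    have h3 := hfst hPcont
    have h4 := hfst hΩcont
    have h5 := hfst hhcont
    have h6 := hfst hyc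
    exact w.continuousOn_current h1 h2 h6 h3 h4 h5
  · intro r hr d p q
    have hr0 : 0 < r := hrp.trans_le hr
    refine w.neg_current_le hrp hr (hfnn r hr) (hfcc r hr) (hh0 r hr) ((hh r hr).trans ?_)
      (hVn r hr) (hVV r hr) (hyb r hr).1 (hym r hr) hΛ (hkP r hr) hδ' ((hΩ1 r hr).trans ?_)
      (hΩ0 r hr) d p q
    · gcongr
      rw [hcc]
      exact le_add_of_nonneg_left (by positivity)
    · gcongr
      linarith
  · intro d p q
    have h0 : f rp = 0 := hhor
    have h1 : w.Ω rp rp = 0 := by simp [Weights.Ω]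
    simp only [Weights.current, h0, hy0, h1]
    have h2 : 0 ≤ w.h rp * (V rp * q ^ 2) :=
      mul_nonneg (hh0 rp le_rfl) (mul_nonneg hV00 (sq_nonneg q))
    have h3 : 0 ≤ w.Λ * ((w.k - w.P rp) * d ^ 2) :=
      mul_nonneg hΛ (mul_nonneg (sub_nonneg.2 (hkP rp le_rfl)) (sq_nonneg d))
    nlinarith [sq_nonneg d]
  · intro r hr φ φr φv prr pvr hφ hφr hφv heq
    have hr0 : 0 < r := hrp.trans hr
    refine ⟨_, w.hasDerivAt_current (V' := fun r => -6 * M / r ^ 4)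
      (f' := fun r => 2 * M / r ^ 2 + 2 * r / l ^ 2) hr0.ne' (lapse_pos hl hrp hhor hr).ne'
      (hasDerivAt_lapse hr0.ne') (hasDerivAt_potential hr0.ne') (hyd r hr) hφ hφr hφv heq, ?_⟩
    have h1 := hbulk r hr (φv r) (φr r) (φ r)
    have h2 := hup r hr.le (φr r) (φ r)
    have h3 : cb * (r ^ 2 * φr r ^ 2 + φ r ^ 2) ≤
        w.ε / (4 * l ^ 2) * (r ^ 2 * φr r ^ 2) + w.δ / 2 * φ r ^ 2 := by
      rw [mul_add]
      gcongr
      · exact min_le_left _ _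
      · exact min_le_right _ _
    have h4 : cb / c₂ * w.energy f V y rp r (φr r) (φ r) ≤
        cb * (r ^ 2 * φr r ^ 2 + φ r ^ 2) := by
      calc cb / c₂ * w.energy f V y rp r (φr r) (φ r)
          ≤ cb / c₂ * (c₂ * (r ^ 2 * φr r ^ 2 + φ r ^ 2)) := by gcongr
        _ = _ := by field_simp
    have h5 : 2 * (f r + w.h r + w.Λ * w.q r * f r) * (φr r * pvr) +
        (2 * (w.δ' * (r - rp)) - 2 * (w.Λ * w.q r * y r)) * (pvr * φ r + φr r * φv r) +
        2 * (V r + w.Λ * w.q r * (y r ^ 2 / f r) + w.δ') * (φ r * φv r) =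
        w.energyDeriv f V y rp r (φr r) (φ r) pvr (φv r) := by
      unfold Weights.energyDeriv
      ring
    rw [h5, hen]
    linarith

end


/-! ### The wave operator in coordinates -/

section Wave

variable {M l : ℝ}

theorem metric_inv {y : Fin 4 → ℝ} (h1 : y 1 ≠ 0) (h2 : Real.sin (y 2) ≠ 0) :
    (metric M l y)⁻¹ = !![0, 1, 0, 0; 1, lapse M l (y 1), 0, 0; 0, 0, ((y 1) ^ 2)⁻¹, 0;
      0, 0, 0, ((y 1) ^ 2 * Real.sin (y 2) ^ 2)⁻¹] := by
  apply Matrix.inv_eq_right_inv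
  have h3 : (y 1) ^ 2 * Real.sin (y 2) ^ 2 ≠ 0 := by positivity
  ext i j
  fin_cases i <;> fin_cases j <;>
    simp [metric, Matrix.mul_apply, Fin.sum_univ_four, h1]
  field_simp

theorem det_metric (y : Fin 4 → ℝ) :
    (metric M l y).det = -((y 1) ^ 2 * Real.sin (y 2)) ^ 2 := by
  simp [metric, Matrix.det_succ_row_zero, Fin.sum_univ_succ, Fin.succAbove]
  ring

theorem sqrt_abs_det_metric {y : Fin 4 → ℝ} (h2 : 0 < Real.sin (y 2)) :
    Real.sqrt |(metric M l y).det| = (y 1) ^ 2 * Real.sin (y 2) := by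
  rw [det_metric, abs_neg, abs_of_nonneg (sq_nonneg _), Real.sqrt_sq (by positivity)]

theorem coordDeriv_symmField_zero (Ψ : ℝ → ℝ → ℝ) (y : Fin 4 → ℝ) :
    coordDeriv 0 (symmField Ψ) y = deriv (fun v => Ψ v (y 1)) (y 0) := by
  simp [coordDeriv, symmField]

theorem coordDeriv_symmField_one (Ψ : ℝ → ℝ → ℝ) (y : Fin 4 → ℝ) :
    coordDeriv 1 (symmField Ψ) y = deriv (fun r => Ψ (y 0) r) (y 1) := by
  simp [coordDeriv, symmField]

theorem coordDeriv_symmField_two (Ψ : ℝ → ℝ → ℝ) (y : Fin 4 → ℝ) :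
    coordDeriv 2 (symmField Ψ) y = 0 := by
  simp [coordDeriv, symmField]

theorem coordDeriv_symmField_three (Ψ : ℝ → ℝ → ℝ) (y : Fin 4 → ℝ) :
    coordDeriv 3 (symmField Ψ) y = 0 := by
  simp [coordDeriv, symmField]

/-- The wave operator on spherically symmetric fields. -/
theorem waveOp_symmField {Ψ ψv ψr : ℝ → ℝ → ℝ} {v0 rp : ℝ} (hrp : 0 < rp)
    (hv : ∀ v r, v0 < v → rp < r → HasDerivAt (fun w => Ψ w r) (ψv v r) v)
    (hr : ∀ v r, v0 < v → rp < r → HasDerivAt (fun s => Ψ v s) (ψr v r) r)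
    {x : Fin 4 → ℝ} (hx0 : v0 < x 0) (hx1 : rp < x 1) (hx2 : 0 < Real.sin (x 2))
    {ψvr ψrv ψrr : ℝ} (hvr : HasDerivAt (fun w => ψr w (x 1)) ψvr (x 0))
    (hrv : HasDerivAt (fun s => ψv (x 0) s) ψrv (x 1))
    (hrr : HasDerivAt (fun s => ψr (x 0) s) ψrr (x 1)) :
    waveOp (metric M l) (symmField Ψ) x = ψvr + ψrv + 2 / x 1 * ψv (x 0) (x 1)
      + lapse M l (x 1) * ψrr + (2 * M / x 1 ^ 2 + 2 * x 1 / l ^ 2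
      + 2 / x 1 * lapse M l (x 1)) * ψr (x 0) (x 1) := by
  have hx1' : 0 < x 1 := hrp.trans hx1
  have key : ∀ y : Fin 4 → ℝ, v0 < y 0 → rp < y 1 → 0 < Real.sin (y 2) → ∀ μ : Fin 4,
      Real.sqrt |(metric M l y).det| *
        ∑ ν, (metric M l y)⁻¹ μ ν * coordDeriv ν (symmField Ψ) y =
      (y 1) ^ 2 * Real.sin (y 2) * ![ψr (y 0) (y 1),
        ψv (y 0) (y 1) + lapse M l (y 1) * ψr (y 0) (y 1), 0, 0] μ := by
    intro y h0 h1 h2 μ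
    rw [sqrt_abs_det_metric h2, metric_inv (hrp.trans h1).ne' h2.ne']
    simp only [Fin.sum_univ_four, coordDeriv_symmField_zero, coordDeriv_symmField_one,
      coordDeriv_symmField_two, coordDeriv_symmField_three, (hv _ _ h0 h1).deriv,
      (hr _ _ h0 h1).deriv]
    fin_cases μ <;> simp
  set H : Fin 4 → (Fin 4 → ℝ) → ℝ := fun μ y => Real.sqrt |(metric M l y).det| *
        ∑ ν, (metric M l y)⁻¹ μ ν * coordDeriv ν (symmField Ψ) y with hH
  have d0 : coordDeriv 0 (H 0) x = (x 1) ^ 2 * Real.sin (x 2) * ψvr := by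
    unfold coordDeriv
    refine HasDerivAt.deriv (HasDerivAt.congr_of_eventuallyEq
      (hvr.const_mul ((x 1) ^ 2 * Real.sin (x 2))) ?_)
    filter_upwards [isOpen_Ioi.mem_nhds hx0] with s hs
    have := key (Function.update x 0 s) (by simpa using hs) (by simpa using hx1)
      (by simpa using hx2) 0
    simpa [hH] using this
  have d1 : coordDeriv 1 (H 1) x = Real.sin (x 2) * (2 * x 1 * (ψv (x 0) (x 1)
      + lapse M l (x 1) * ψr (x 0) (x 1)) + (x 1) ^ 2 * (ψrv + ((2 * M / x 1 ^ 2 + 2 * x 1 / l ^ 2)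
      * ψr (x 0) (x 1) + lapse M l (x 1) * ψrr))) := by
    unfold coordDeriv
    have hd := ((hasDerivAt_pow 2 (x 1)).mul
      (hrv.add ((hasDerivAt_lapse (M := M) (l := l) hx1'.ne').mul hrr))).const_mul
      (Real.sin (x 2))
    refine HasDerivAt.deriv (HasDerivAt.congr_of_eventuallyEq (hd.congr_deriv ?_) ?_)
    · simp
    · filter_upwards [isOpen_Ioi.mem_nhds hx1] with s hs
      have := key (Function.update x 1 s) (by simpa using hx0) (by simpa using hs)
        (by simpa using hx2) 1
      simp only [hH]
      rw [this]
      simp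
      ring
  have d2 : coordDeriv 2 (H 2) x = 0 := by
    unfold coordDeriv
    have hopen : IsOpen {s : ℝ | 0 < Real.sin s} :=
      isOpen_lt continuous_const Real.continuous_sin
    refine HasDerivAt.deriv ((hasDerivAt_const (x 2) (0 : ℝ)).congr_of_eventuallyEq ?_)
    filter_upwards [hopen.mem_nhds hx2] with s hs
    have := key (Function.update x 2 s) (by simpa using hx0) (by simpa using hx1)
      (by simpa using hs) 2
    simpa [hH] using this
  have d3 : coordDeriv 3 (H 3) x = 0 := by
    unfold coordDeriv
    have : (fun s => H 3 (Function.update x 3 s)) = fun _ => 0 := by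
      funext s
      have := key (Function.update x 3 s) (by simpa using hx0) (by simpa using hx1)
        (by simpa using hx2) 3
      simpa [hH] using this
    rw [this]
    simp
  have hw : waveOp (metric M l) (symmField Ψ) x = (Real.sqrt |(metric M l x).det|)⁻¹ *
      ∑ μ, coordDeriv μ (H μ) x := rfl
  rw [hw, Fin.sum_univ_four, d0, d1, d2, d3, sqrt_abs_det_metric hx2]
  have hs := hx2.ne'
  have h1 := hx1'.ne'
  generalize Real.sin (x 2) = S at hs
  generalize x 1 = r at h1
  generalize lapse M l r = F
  -- No sign of l is assumed; for l = 0 the terms divided by l² are zero on both sides.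
  by_cases hl : l = 0
  · subst hl
    simp only [ne_eq, OfNat.ofNat_ne_zero, not_false_eq_true, zero_pow, div_zero]
    field_simp
    ring
  · field_simp
    ring

end Wave


/-! ### Partial derivatives up to the boundary and the rescaled field -/

section Fields

variable {v0 rp : ℝ} {g : ℝ × ℝ → ℝ}

theorem uniqueDiffOn_exterior : UniqueDiffOn ℝ (Ici v0 ×ˢ Ici rp) :=
  (uniqueDiffOn_Ici v0).prod (uniqueDiffOn_Ici rp)

theorem hasDerivWithinAt_fst (hg : DifferentiableOn ℝ g (Ici v0 ×ˢ Ici rp)) {v r : ℝ}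
    (hv : v0 ≤ v) (hr : rp ≤ r) :
    HasDerivWithinAt (fun w => g (w, r)) (fderivWithin ℝ g (Ici v0 ×ˢ Ici rp) (v, r) (1, 0))
      (Ici v0) v := by
  have h := (hg (v, r) ⟨hv, hr⟩).hasFDerivWithinAt
  have hc : HasDerivWithinAt (fun w : ℝ => (w, r)) ((1 : ℝ), (0 : ℝ)) (Ici v0) v :=
    (hasDerivWithinAt_id v _).prodMk (hasDerivWithinAt_const v _ r)
  exact h.comp_hasDerivWithinAt v hc (t := Ici v0 ×ˢ Ici rp) fun w hw => mk_mem_prod hw hr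

theorem hasDerivWithinAt_snd (hg : DifferentiableOn ℝ g (Ici v0 ×ˢ Ici rp)) {v r : ℝ}
    (hv : v0 ≤ v) (hr : rp ≤ r) :
    HasDerivWithinAt (fun s => g (v, s)) (fderivWithin ℝ g (Ici v0 ×ˢ Ici rp) (v, r) (0, 1))
      (Ici rp) r := by
  have h := (hg (v, r) ⟨hv, hr⟩).hasFDerivWithinAt
  have hc : HasDerivWithinAt (fun s : ℝ => (v, s)) ((0 : ℝ), (1 : ℝ)) (Ici rp) r :=
    (hasDerivWithinAt_const r _ v).prodMk (hasDerivWithinAt_id r _)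
  exact h.comp_hasDerivWithinAt r hc (t := Ici v0 ×ˢ Ici rp) fun w hw => mk_mem_prod hv hw

/-- The wave operator produces both mixed derivatives; their equality in the interior merges them
into the single term 2φ_vr. -/
theorem fderivWithin_fderivWithin_symm (hg : ContDiffOn ℝ 2 g (Ici v0 ×ˢ Ici rp)) {v r : ℝ}
    (hv : v0 < v) (hr : rp < r) :
    fderivWithin ℝ (fun p => fderivWithin ℝ g (Ici v0 ×ˢ Ici rp) p (0, 1)) (Ici v0 ×ˢ Ici rp)
        (v, r) (1, 0) =
      fderivWithin ℝ (fun p => fderivWithin ℝ g (Ici v0 ×ˢ Ici rp) p (1, 0)) (Ici v0 ×ˢ Ici rp)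
        (v, r) (0, 1) := by
  set S := Ici v0 ×ˢ Ici rp with hS
  have hmem : S ∈ nhds (v, r) := prod_mem_nhds (Ici_mem_nhds hv) (Ici_mem_nhds hr)
  have hp : (v, r) ∈ S := ⟨hv.le, hr.le⟩
  have hD : DifferentiableWithinAt ℝ (fderivWithin ℝ g S) S (v, r) :=
    (hg.fderivWithin uniqueDiffOn_exterior (m := 1) (by norm_num)).differentiableOn (by norm_num) _ hp
  have hsymm := (hg.contDiffWithinAt hp).isSymmSndFDerivWithinAt (by simp)
    uniqueDiffOn_exterior (subset_closure (mem_interior_iff_mem_nhds.2 hmem)) hp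
  have h := hsymm (1, 0) (0, 1)
  have e : ∀ u w : ℝ × ℝ, fderivWithin ℝ (fun p => fderivWithin ℝ g S p u) S (v, r) w =
      fderivWithin ℝ (fderivWithin ℝ g S) S (v, r) w u := by
    intro u w
    have := (hD.hasFDerivWithinAt.clm_apply (hasFDerivWithinAt_const u (v, r) S)).fderivWithin
      (uniqueDiffOn_exterior _ hp)
    rw [this]
    simp
  rw [e, e]
  exact h

end Fields

/-- The field `φ = r ψ` of a spherically symmetric solution together with its partial derivatives,
extended continuously to all of `ℝ²`. -/
structure RescaledField (M l a rp v0 : ℝ) (Ψ : ℝ → ℝ → ℝ) where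
  (φ φv φr φrv φrr : ℝ → ℝ → ℝ)
  continuous_φ : Continuous fun p : ℝ × ℝ => φ p.1 p.2
  continuous_φv : Continuous fun p : ℝ × ℝ => φv p.1 p.2
  continuous_φr : Continuous fun p : ℝ × ℝ => φr p.1 p.2
  continuous_φrv : Continuous fun p : ℝ × ℝ => φrv p.1 p.2
  φ_eq : ∀ v r, v0 ≤ v → rp ≤ r → φ v r = r * Ψ v r
  φv_eq : ∀ v r, v0 ≤ v → rp ≤ r → φv v r = r * killingDeriv v0 Ψ v r
  φr_eq : ∀ v r, v0 ≤ v → rp < r → φr v r = Ψ v r + r * deriv (fun s => Ψ v s) r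
  hasDerivAt_φ_r : ∀ v r, v0 ≤ v → rp < r → HasDerivAt (φ v) (φr v r) r
  hasDerivAt_φr_r : ∀ v r, v0 ≤ v → rp < r → HasDerivAt (φr v) (φrr v r) r
  hasDerivAt_φv_r : ∀ v r, v0 < v → rp < r → HasDerivAt (φv v) (φrv v r) r
  hasDerivAt_φ_v : ∀ v r, v0 < v → rp < r → HasDerivAt (fun w => φ w r) (φv v r) v
  hasDerivAt_φr_v : ∀ v r, v0 < v → rp < r → HasDerivAt (fun w => φr w r) (φrv v r) v
  wave : ∀ v r, v0 < v → rp < r → 2 * φrv v r + lapse M l r * φrr v r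
    + (2 * M / r ^ 2 + 2 * r / l ^ 2) * φr v r - potential M l a r * φ v r = 0

/-- Constant extension of a function on a quadrant to the plane. -/
def clampExt (v0 rp : ℝ) (g : ℝ × ℝ → ℝ) (v r : ℝ) : ℝ := g (max v0 v, max rp r)

theorem clampExt_eq {v0 rp : ℝ} (g : ℝ × ℝ → ℝ) {v r : ℝ} (hv : v0 ≤ v) (hr : rp ≤ r) :
    clampExt v0 rp g v r = g (v, r) := by
  rw [clampExt, max_eq_right hv, max_eq_right hr]

theorem continuous_clampExt {v0 rp : ℝ} {g : ℝ × ℝ → ℝ}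
    (hg : ContinuousOn g (Ici v0 ×ˢ Ici rp)) :
    Continuous fun p : ℝ × ℝ => clampExt v0 rp g p.1 p.2 :=
  hg.comp_continuous (f := fun p : ℝ × ℝ => (max v0 p.1, max rp p.2)) (by fun_prop)
    fun p => mk_mem_prod (le_max_left v0 p.1) (le_max_left rp p.2)

theorem hasDerivAt_clampExt_r {v0 rp : ℝ} {g : ℝ × ℝ → ℝ} {v r g' : ℝ} (hv : v0 ≤ v) (hr : rp < r)
    (h : HasDerivAt (fun s => g (v, s)) g' r) : HasDerivAt (clampExt v0 rp g v) g' r := by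
  refine h.congr_of_eventuallyEq ?_
  filter_upwards [Ioi_mem_nhds hr] with s hs using clampExt_eq g hv (le_of_lt hs)

theorem hasDerivAt_clampExt_v {v0 rp : ℝ} {g : ℝ × ℝ → ℝ} {v r g' : ℝ} (hv : v0 < v) (hr : rp ≤ r)
    (h : HasDerivAt (fun w => g (w, r)) g' v) :
    HasDerivAt (fun w => clampExt v0 rp g w r) g' v := by
  refine h.congr_of_eventuallyEq ?_
  filter_upwards [Ioi_mem_nhds hv] with s hs using clampExt_eq g (le_of_lt hs) hr

theorem IsSolution.nonempty_rescaledField {M l a rp v0 : ℝ} {Ψ : ℝ → ℝ → ℝ} (hl : 0 < l)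
    (hrp : 0 < rp) (h : IsSolution M l a rp v0 Ψ) : Nonempty (RescaledField M l a rp v0 Ψ) := by
  set S := Ici v0 ×ˢ Ici rp with hS
  set g : ℝ × ℝ → ℝ := fun p => Ψ p.1 p.2 with hg
  have hg2 : ContDiffOn ℝ 2 g S := h.contDiffOn
  have hD : ContDiffOn ℝ 1 (fderivWithin ℝ g S) S :=
    hg2.fderivWithin uniqueDiffOn_exterior (by norm_num)
  set gv : ℝ × ℝ → ℝ := fun p => fderivWithin ℝ g S p (1, 0) with hgv
  set gr : ℝ × ℝ → ℝ := fun p => fderivWithin ℝ g S p (0, 1) with hgr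
  have hgv1 : ContDiffOn ℝ 1 gv S := hD.clm_apply contDiffOn_const
  have hgr1 : ContDiffOn ℝ 1 gr S := hD.clm_apply contDiffOn_const
  set gvr : ℝ × ℝ → ℝ := fun p => fderivWithin ℝ gr S p (1, 0) with hgvr
  set grr : ℝ × ℝ → ℝ := fun p => fderivWithin ℝ gr S p (0, 1) with hgrr
  have hgvrc : ContinuousOn gvr S :=
    (hgr1.continuousOn_fderivWithin uniqueDiffOn_exterior (by norm_num)).clm_apply
      continuousOn_const
  have hsymm : ∀ v r, v0 < v → rp < r → fderivWithin ℝ gv S (v, r) (0, 1) = gvr (v, r) :=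
    fun v r hv hr => (fderivWithin_fderivWithin_symm hg2 hv hr).symm
  have hgd : DifferentiableOn ℝ g S := hg2.differentiableOn (by norm_num)
  have hgvd : DifferentiableOn ℝ gv S := hgv1.differentiableOn (by norm_num)
  have hgrd : DifferentiableOn ℝ gr S := hgr1.differentiableOn (by norm_num)
  have dr : ∀ v r, v0 ≤ v → rp < r → HasDerivAt (fun s => g (v, s)) (gr (v, r)) r :=
    fun v r hv hr => (hasDerivWithinAt_snd hgd hv hr.le).hasDerivAt (Ici_mem_nhds hr)
  have dv : ∀ v r, v0 < v → rp ≤ r → HasDerivAt (fun w => g (w, r)) (gv (v, r)) v :=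
    fun v r hv hr => (hasDerivWithinAt_fst hgd hv.le hr).hasDerivAt (Ici_mem_nhds hv)
  have drr : ∀ v r, v0 ≤ v → rp < r → HasDerivAt (fun s => gr (v, s)) (grr (v, r)) r :=
    fun v r hv hr => (hasDerivWithinAt_snd hgrd hv hr.le).hasDerivAt (Ici_mem_nhds hr)
  have dvr : ∀ v r, v0 < v → rp < r → HasDerivAt (fun w => gr (w, r)) (gvr (v, r)) v :=
    fun v r hv hr => (hasDerivWithinAt_fst hgrd hv.le hr.le).hasDerivAt (Ici_mem_nhds hv)
  have drv : ∀ v r, v0 < v → rp < r → HasDerivAt (fun s => gv (v, s)) (gvr (v, r)) r :=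
    fun v r hv hr => by
      rw [← hsymm v r hv hr]
      exact (hasDerivWithinAt_snd hgvd hv.le hr.le).hasDerivAt (Ici_mem_nhds hr)
  refine ⟨⟨clampExt v0 rp fun p => p.2 * g p, clampExt v0 rp fun p => p.2 * gv p,
    clampExt v0 rp fun p => g p + p.2 * gr p, clampExt v0 rp fun p => gv p + p.2 * gvr p,
    clampExt v0 rp fun p => 2 * gr p + p.2 * grr p,
    continuous_clampExt (continuousOn_snd.mul hgd.continuousOn),
    continuous_clampExt (continuousOn_snd.mul hgvd.continuousOn),
    continuous_clampExt (hgd.continuousOn.add (continuousOn_snd.mul hgrd.continuousOn)),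
    continuous_clampExt (hgvd.continuousOn.add (continuousOn_snd.mul hgvrc)),
    fun v r hv hr => clampExt_eq _ hv hr, ?_, ?_, ?_, ?_, ?_, ?_, ?_, ?_⟩⟩
  · intro v r hv hr
    rw [clampExt_eq _ hv hr, killingDeriv,
      (hasDerivWithinAt_fst hgd hv hr).derivWithin (uniqueDiffOn_Ici v0 v hv)]
  · intro v r hv hr
    rw [clampExt_eq _ hv hr.le, (dr v r hv hr).deriv]
  · intro v r hv hr
    rw [clampExt_eq _ hv hr.le]
    exact hasDerivAt_clampExt_r hv hr
      (((hasDerivAt_id r).mul (dr v r hv hr)).congr_deriv (by simp))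
  · intro v r hv hr
    rw [clampExt_eq _ hv hr.le]
    exact hasDerivAt_clampExt_r hv hr
      (((dr v r hv hr).add ((hasDerivAt_id r).mul (drr v r hv hr))).congr_deriv (by simp; ring))
  · intro v r hv hr
    rw [clampExt_eq _ hv.le hr.le]
    exact hasDerivAt_clampExt_r hv.le hr
      (((hasDerivAt_id r).mul (drv v r hv hr)).congr_deriv (by simp))
  · intro v r hv hr
    rw [clampExt_eq _ hv.le hr.le]
    exact hasDerivAt_clampExt_v hv hr.le ((dv v r hv hr.le).const_mul r)
  · intro v r hv hr
    rw [clampExt_eq _ hv.le hr.le]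
    exact hasDerivAt_clampExt_v hv hr.le ((dv v r hv hr.le).add ((dvr v r hv hr).const_mul r))
  · intro v r hv hr
    have hr0 : 0 < r := hrp.trans hr
    rw [clampExt_eq _ hv.le hr.le, clampExt_eq _ hv.le hr.le, clampExt_eq _ hv.le hr.le,
      clampExt_eq _ hv.le hr.le]
    -- By spherical symmetry it is enough to evaluate the equation on the equator, where sin θ = 1.
    have hpi : (0 : ℝ) < Real.pi / 2 := by positivity
    have hw := h.wave_eq ![v, r, Real.pi / 2, 0] (by simpa using hv) (by simpa using hr)
      (by simpa using hpi) (by simp [Real.pi_pos])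
    rw [waveOp_symmField (ψv := fun v r => gv (v, r)) (ψr := fun v r => gr (v, r)) hrp
      (fun v r hv hr => dv v r hv hr.le) (fun v r hv hr => dr v r hv.le hr)
      (x := ![v, r, Real.pi / 2, 0]) (by simpa using hv) (by simpa using hr) (by simp)
      (dvr v r hv hr) (drv v r hv hr) (drr v r hv.le hr)] at hw
    simp only [symmField, Matrix.cons_val_zero, Matrix.cons_val_one] at hw
    simp only [hg, potential]
    unfold lapse at *
    field_simp at hw ⊢
    linear_combination r * hw


/-! ### Linear cutoffs and vanishing averages -/

section Averages

open Filter Topology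

variable {rp : ℝ} {g : ℝ → ℝ}

theorem average_mul_le (hrp : 0 < rp) (hg : Continuous g) (hg0 : ∀ r, 0 ≤ g r)
    (hgi : IntegrableOn g (Ioi rp)) {N : ℝ} (hN : rp < N) :
    1 / N * ∫ r in rp..N, r * g r ≤ ∫ r in Ioi rp, g r := by
  have hN0 : 0 < N := hrp.trans hN
  rw [← intervalIntegral.integral_const_mul]
  calc ∫ r in rp..N, 1 / N * (r * g r) ≤ ∫ r in rp..N, g r := by
        refine intervalIntegral.integral_mono_on hN.le
          (Continuous.intervalIntegrable (by fun_prop) _ _) (hg.intervalIntegrable _ _)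
          fun r hr => ?_
        rw [← mul_assoc, one_div_mul_eq_div]
        exact mul_le_of_le_one_left (hg0 r) ((div_le_one hN0).2 hr.2)
    _ = ∫ r in Ioc rp N, g r := intervalIntegral.integral_of_le hN.le
    _ ≤ ∫ r in Ioi rp, g r := setIntegral_mono_set hgi (ae_of_all _ hg0)
        (LE.le.eventuallyLE Ioc_subset_Ioi_self)

theorem average_mul_nonneg (hrp : 0 < rp) (hg0 : ∀ r, 0 ≤ g r) {N : ℝ} (hN : rp < N) :
    0 ≤ 1 / N * ∫ r in rp..N, r * g r := by
  have hN0 : 0 < N := hrp.trans hN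
  refine mul_nonneg (by positivity) (intervalIntegral.integral_nonneg hN.le fun r hr => ?_)
  exact mul_nonneg (hrp.le.trans hr.1) (hg0 r)

/-- The integrand (r/N)g on r ≤ N is dominated by g and tends to 0 pointwise. This replaces any
pointwise boundary condition at infinity. -/
theorem tendsto_average_mul (hrp : 0 < rp) (hg : Continuous g) (hg0 : ∀ r, 0 ≤ g r)
    (hgi : IntegrableOn g (Ioi rp)) :
    Tendsto (fun N : ℝ => 1 / N * ∫ r in rp..N, r * g r) atTop (𝓝 0) := by
  have h : Tendsto (fun N : ℝ => ∫ r in Ioi rp, (Iic N).indicator (fun r => 1 / N * (r * g r)) r)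
      atTop (𝓝 (∫ _ in Ioi rp, (0 : ℝ))) := by
    refine tendsto_integral_filter_of_dominated_convergence g ?_ ?_ hgi ?_
    · exact Eventually.of_forall fun N =>
        ((by fun_prop : Continuous fun r => 1 / N * (r * g r)).aestronglyMeasurable).indicator
          measurableSet_Iic
    · filter_upwards [eventually_gt_atTop rp] with N hN
      have hN0 : 0 < N := hrp.trans hN
      filter_upwards [ae_restrict_mem measurableSet_Ioi] with r hr
      have hr0 : 0 < r := hrp.trans hr
      by_cases hrN : r ∈ Iic N
      · rw [indicator_of_mem hrN, ← mul_assoc, one_div_mul_eq_div,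
          Real.norm_of_nonneg (mul_nonneg (by positivity) (hg0 r))]
        exact mul_le_of_le_one_left (hg0 r) ((div_le_one hN0).2 hrN)
      · rw [indicator_of_notMem hrN, norm_zero]
        exact hg0 r
    · refine ae_of_all _ fun r => ?_
      have h1 : Tendsto (fun N : ℝ => 1 / N * (r * g r)) atTop (𝓝 0) := by
        have := (tendsto_inv_atTop_zero (𝕜 := ℝ)).mul_const (r * g r)
        simpa [one_div] using this
      refine squeeze_zero_norm' (Eventually.of_forall fun N => ?_) (tendsto_zero_iff_norm_tendsto_zero.1 h1)
      exact norm_indicator_le_norm_self _ _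
  rw [integral_zero] at h
  refine h.congr' ?_
  filter_upwards [eventually_gt_atTop rp] with N hN
  rw [← intervalIntegral.integral_const_mul, intervalIntegral.integral_of_le hN.le,
    setIntegral_indicator measurableSet_Iic, Ioi_inter_Iic]

theorem tendsto_cutoff_integral (hrp : 0 < rp) (hg : Continuous g) (hg0 : ∀ r, 0 ≤ g r)
    (hgi : IntegrableOn g (Ioi rp)) :
    Tendsto (fun N : ℝ => ∫ r in rp..N, (1 - r / N) * g r) atTop (𝓝 (∫ r in Ioi rp, g r)) := by
  have h1 := intervalIntegral_tendsto_integral_Ioi (b := fun N : ℝ => N) rp hgi tendsto_id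
  have h2 := h1.sub (tendsto_average_mul hrp hg hg0 hgi)
  rw [sub_zero] at h2
  refine h2.congr fun N => ?_
  rw [← intervalIntegral.integral_const_mul, ← intervalIntegral.integral_sub
    (hg.intervalIntegrable _ _) (Continuous.intervalIntegrable (by fun_prop) _ _)]
  refine intervalIntegral.integral_congr fun r _ => ?_
  ring

end Averages

/-! ### The cutoff energy inequality -/

section Decay

variable {M l a rp v0 : ℝ} {Ψ : ℝ → ℝ → ℝ}

/-- The density `r² φ_r² + φ²`. -/
def RescaledField.density (X : RescaledField M l a rp v0 Ψ) (v r : ℝ) : ℝ :=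
  r ^ 2 * X.φr v r ^ 2 + X.φ v r ^ 2

/-- The energy density of a field. -/
def EnergyCurrent.energy (E : EnergyCurrent M l a rp) (X : RescaledField M l a rp v0 Ψ)
    (v r : ℝ) : ℝ :=
  E.A (max rp r) * X.φr v r ^ 2 + E.B (max rp r) * (X.φr v r * X.φ v r)
    + E.Γ (max rp r) * X.φ v r ^ 2

/-- The `v`-derivative of the energy density of a field. -/
def EnergyCurrent.energyDeriv (E : EnergyCurrent M l a rp) (X : RescaledField M l a rp v0 Ψ)
    (v r : ℝ) : ℝ :=
  2 * E.A (max rp r) * (X.φr v r * X.φrv v r)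
    + E.B (max rp r) * (X.φrv v r * X.φ v r + X.φr v r * X.φv v r)
    + 2 * E.Γ (max rp r) * (X.φ v r * X.φv v r)

theorem continuous_comp_max {A : ℝ → ℝ} (hA : ContinuousOn A (Ici rp)) :
    Continuous fun r => A (max rp r) :=
  hA.comp_continuous (by fun_prop) fun r => le_max_left rp r

theorem RescaledField.density_nonneg (X : RescaledField M l a rp v0 Ψ) (v r : ℝ) :
    0 ≤ X.density v r := by
  unfold density
  positivity

theorem RescaledField.continuous_density (X : RescaledField M l a rp v0 Ψ) :
    Continuous fun p : ℝ × ℝ => X.density p.1 p.2 := by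
  have h1 := X.continuous_φ
  have h2 := X.continuous_φr
  unfold density
  fun_prop

theorem EnergyCurrent.continuous_energy (E : EnergyCurrent M l a rp)
    (X : RescaledField M l a rp v0 Ψ) : Continuous fun p : ℝ × ℝ => E.energy X p.1 p.2 := by
  have h1 := X.continuous_φ
  have h2 := X.continuous_φr
  have h3 := (continuous_comp_max E.continuousOn_A).comp (continuous_snd (X := ℝ))
  have h4 := (continuous_comp_max E.continuousOn_B).comp (continuous_snd (X := ℝ))
  have h5 := (continuous_comp_max E.continuousOn_Γ).comp (continuous_snd (X := ℝ))
  unfold energy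
  exact ((h3.mul (h2.pow 2)).add (h4.mul (h2.mul h1))).add (h5.mul (h1.pow 2))

theorem EnergyCurrent.continuous_energyDeriv (E : EnergyCurrent M l a rp)
    (X : RescaledField M l a rp v0 Ψ) : Continuous fun p : ℝ × ℝ => E.energyDeriv X p.1 p.2 := by
  have h1 := X.continuous_φ
  have h2 := X.continuous_φr
  have h6 := X.continuous_φv
  have h7 := X.continuous_φrv
  have h3 := (continuous_comp_max E.continuousOn_A).comp (continuous_snd (X := ℝ))
  have h4 := (continuous_comp_max E.continuousOn_B).comp (continuous_snd (X := ℝ))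
  have h5 := (continuous_comp_max E.continuousOn_Γ).comp (continuous_snd (X := ℝ))
  unfold energyDeriv
  exact (((continuous_const.mul h3).mul (h2.mul h7)).add (h4.mul ((h7.mul h1).add (h2.mul h6)))).add
    ((continuous_const.mul h5).mul (h1.mul h6))

theorem EnergyCurrent.hasDerivAt_energy (E : EnergyCurrent M l a rp)
    (X : RescaledField M l a rp v0 Ψ) {v r : ℝ} (hv : v0 < v) (hr : rp < r) :
    HasDerivAt (fun w => E.energy X w r) (E.energyDeriv X v r) v := by
  have h1 := X.hasDerivAt_φ_v v r hv hr
  have h2 := X.hasDerivAt_φr_v v r hv hr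
  have h := (((h2.pow 2).const_mul (E.A (max rp r))).add
    ((h2.mul h1).const_mul (E.B (max rp r)))).add ((h1.pow 2).const_mul (E.Γ (max rp r)))
  refine HasDerivAt.congr_deriv h ?_
  unfold energyDeriv
  norm_num
  ring

theorem EnergyCurrent.density_le_energy (E : EnergyCurrent M l a rp)
    (X : RescaledField M l a rp v0 Ψ) {v r : ℝ} (hr : rp ≤ r) :
    E.c₁ * X.density v r ≤ E.energy X v r := by
  unfold energy RescaledField.density
  rw [max_eq_right hr]
  exact E.density_ge r hr _ _

theorem EnergyCurrent.energy_le_density (E : EnergyCurrent M l a rp)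
    (X : RescaledField M l a rp v0 Ψ) {v r : ℝ} (hr : rp ≤ r) :
    E.energy X v r ≤ E.c₂ * X.density v r := by
  unfold energy RescaledField.density
  rw [max_eq_right hr]
  exact E.density_le r hr _ _

/-- Integrating the divergence inequality against 1 - r/N removes the boundary term at N, leaves one
of favourable sign at the horizon, and turns the derivative of the cutoff into (1/N) times the
current. -/
theorem EnergyCurrent.integral_cutoff_energyDeriv_le (E : EnergyCurrent M l a rp)
    (X : RescaledField M l a rp v0 Ψ) (hrp : 0 < rp) {v N : ℝ} (hv : v0 < v) (hN : rp < N) :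
    ∫ r in rp..N, (1 - r / N) * (E.energyDeriv X v r + E.c₄ * E.energy X v r) ≤
      E.c₃ * (1 / N * ∫ r in rp..N, r * (X.φv v r ^ 2 + X.density v r)) := by
  have hN0 : 0 < N := hrp.trans hN
  have c1 : Continuous fun r => E.energy X v r :=
    (E.continuous_energy X).comp (by fun_prop : Continuous fun r : ℝ => (v, r))
  have c2 : Continuous fun r => E.energyDeriv X v r :=
    (E.continuous_energyDeriv X).comp (by fun_prop : Continuous fun r : ℝ => (v, r))
  have c3 : Continuous fun r => X.density v r :=
    X.continuous_density.comp (by fun_prop : Continuous fun r : ℝ => (v, r))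
  have c4 : Continuous fun r => X.φv v r :=
    X.continuous_φv.comp (by fun_prop : Continuous fun r : ℝ => (v, r))
  have c5 : Continuous fun r => X.φr v r :=
    X.continuous_φr.comp (by fun_prop : Continuous fun r : ℝ => (v, r))
  have c6 : Continuous fun r => X.φ v r :=
    X.continuous_φ.comp (by fun_prop : Continuous fun r : ℝ => (v, r))
  set F : ℝ → ℝ := fun r => (1 - r / N) * (E.energyDeriv X v r + E.c₄ * E.energy X v r) -
    E.c₃ * (1 / N * (r * (X.φv v r ^ 2 + X.density v r))) with hF
  set G : ℝ → ℝ := fun r => -((1 - r / N) * E.J r (X.φv v r) (X.φr v r) (X.φ v r)) with hG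
  have hJ : ∀ r, rp < r → ∃ J', HasDerivAt (fun s => E.J s (X.φv v s) (X.φr v s) (X.φ v s)) J' r ∧
      E.energyDeriv X v r + J' ≤ -E.c₄ * E.energy X v r := by
    intro r hr
    obtain ⟨J', h1, h2⟩ := E.divergence r hr (X.φ v) (X.φr v) (X.φv v) (X.φrr v r) (X.φrv v r)
      (X.hasDerivAt_φ_r v r hv.le hr) (X.hasDerivAt_φr_r v r hv.le hr)
      (X.hasDerivAt_φv_r v r hv hr) (X.wave v r hv hr)
    refine ⟨J', h1, ?_⟩
    unfold energyDeriv energy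
    rw [max_eq_right hr.le]
    exact h2
  choose! J' hJd hJle using hJ
  -- This form of the fundamental theorem needs only an integrable function F below the derivative
  -- of G, so nothing is required of J' itself, which contains φ_rr.
  have hle := intervalIntegral.integral_le_sub_of_hasDeriv_right_of_le (g := G)
    (g' := fun r => -(-(1 / N) * E.J r (X.φv v r) (X.φr v r) (X.φ v r) + (1 - r / N) * J' r))
    (φ := F) hN.le ?_ ?_ ?_ ?_
  · have hsplit : ∫ r in rp..N, F r =
        (∫ r in rp..N, (1 - r / N) * (E.energyDeriv X v r + E.c₄ * E.energy X v r)) -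
        E.c₃ * (1 / N * ∫ r in rp..N, r * (X.φv v r ^ 2 + X.density v r)) := by
      rw [hF, intervalIntegral.integral_sub (Continuous.intervalIntegrable (by fun_prop) _ _)
        (Continuous.intervalIntegrable (by fun_prop) _ _), intervalIntegral.integral_const_mul,
        intervalIntegral.integral_const_mul]
    have hGN : G N = 0 := by simp [hG, div_self hN0.ne']
    have hGrp : 0 ≤ G rp := by
      have h1 : 0 ≤ 1 - rp / N := sub_nonneg.2 ((div_le_one hN0).2 hN.le)
      have h2 := E.J_horizon (X.φv v rp) (X.φr v rp) (X.φ v rp)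
      simp only [hG]
      nlinarith
    rw [hsplit] at hle
    linarith
  · have hcJ : ContinuousOn (fun r => E.J r (X.φv v r) (X.φr v r) (X.φ v r)) (Icc rp N) :=
      E.continuousOn_J.comp (f := fun r => (r, X.φv v r, X.φr v r, X.φ v r))
        (by fun_prop) fun r hr => ⟨hr.1, mem_univ _⟩
    exact ((by fun_prop : Continuous fun r : ℝ => 1 - r / N).continuousOn.mul hcJ).neg
  · intro r hr
    have h1 : HasDerivAt (fun r : ℝ => 1 - r / N) (-(1 / N)) r :=
      ((hasDerivAt_id r).div_const N).const_sub 1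
    exact (h1.mul (hJd r hr.1)).neg.hasDerivWithinAt
  · exact (by fun_prop : Continuous F).continuousOn.integrableOn_Icc
  · intro r hr
    have h1 : 0 ≤ 1 - r / N := sub_nonneg.2 ((div_le_one hN0).2 hr.2.le)
    have h2 := mul_le_mul_of_nonneg_left (hJle r hr.1) h1
    have h3 := mul_le_mul_of_nonneg_left
      (E.neg_J_le r hr.1.le (X.φv v r) (X.φr v r) (X.φ v r)) (one_div_pos.2 hN0).le
    simp only [hF, RescaledField.density] at *
    linarith

/-- Grönwall in integrated form: e^(c₄v) times the density is integrated in v at each fixed r, and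
Fubini replaces differentiation under the integral sign. -/
theorem EnergyCurrent.cutoff_energy_le (E : EnergyCurrent M l a rp)
    (X : RescaledField M l a rp v0 Ψ) (hrp : 0 < rp) {v N : ℝ} (hv : v0 ≤ v) (hN : rp < N) :
    Real.exp (E.c₄ * v) * (∫ r in rp..N, (1 - r / N) * E.energy X v r) -
      Real.exp (E.c₄ * v0) * (∫ r in rp..N, (1 - r / N) * E.energy X v0 r) ≤
      ∫ w in v0..v, Real.exp (E.c₄ * w) *
        (E.c₃ * (1 / N * ∫ r in rp..N, r * (X.φv w r ^ 2 + X.density w r))) := by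
  have c1 := E.continuous_energy X
  have c2 := E.continuous_energyDeriv X
  have c3 := X.continuous_density
  have c4 := X.continuous_φv
  set H : ℝ → ℝ → ℝ := fun r w => Real.exp (E.c₄ * w) *
    ((1 - r / N) * (E.energyDeriv X w r + E.c₄ * E.energy X w r)) with hH
  have sw : Continuous fun p : ℝ × ℝ => (p.2, p.1) := by fun_prop
  have hHc : Continuous (Function.uncurry H) := by
    have e1 := c1.comp sw
    have e2 := c2.comp sw
    exact (by fun_prop : Continuous fun p : ℝ × ℝ => Real.exp (E.c₄ * p.2)).mul
      ((by fun_prop : Continuous fun p : ℝ × ℝ => 1 - p.1 / N).mul (e2.add (e1.const_mul _)))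
  have hHr : ∀ r, rp < r → ∫ w in v0..v, H r w = Real.exp (E.c₄ * v) *
      ((1 - r / N) * E.energy X v r) - Real.exp (E.c₄ * v0) * ((1 - r / N) * E.energy X v0 r) := by
    intro r hr
    have hc : Continuous fun w : ℝ => Real.exp (E.c₄ * w) * ((1 - r / N) * E.energy X w r) := by
      have := c1.comp (by fun_prop : Continuous fun w : ℝ => (w, r))
      exact (by fun_prop : Continuous fun w : ℝ => Real.exp (E.c₄ * w)).mul (this.const_mul _)
    refine intervalIntegral.integral_eq_sub_of_hasDerivAt_of_le
      (f := fun w => Real.exp (E.c₄ * w) * ((1 - r / N) * E.energy X w r)) hv hc.continuousOn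
      (fun w hw => ?_) ?_
    · have he : HasDerivAt (fun w => Real.exp (E.c₄ * w)) (Real.exp (E.c₄ * w) * (E.c₄ * 1)) w :=
        ((hasDerivAt_id w).const_mul E.c₄).exp
      refine (he.mul ((E.hasDerivAt_energy X hw.1 hr).const_mul (1 - r / N))).congr_deriv ?_
      simp only [hH]
      ring
    · exact (hHc.comp (by fun_prop : Continuous fun w : ℝ => (r, w))).intervalIntegrable _ _
  have hswap : ∫ r in rp..N, ∫ w in v0..v, H r w = ∫ w in v0..v, ∫ r in rp..N, H r w := by
    apply intervalIntegral_intervalIntegral_swap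
    exact (hHc.continuousOn.integrableOn_compact (isCompact_uIcc.prod isCompact_uIcc)).mono_set
      (prod_mono uIoc_subset_uIcc uIoc_subset_uIcc)
  have hlhs : ∫ r in rp..N, ∫ w in v0..v, H r w =
      Real.exp (E.c₄ * v) * (∫ r in rp..N, (1 - r / N) * E.energy X v r) -
      Real.exp (E.c₄ * v0) * (∫ r in rp..N, (1 - r / N) * E.energy X v0 r) := by
    have d1 : ∀ w, Continuous fun r => E.energy X w r := fun w =>
      c1.comp (by fun_prop : Continuous fun r : ℝ => (w, r))
    have d2 := d1 v
    have d3 := d1 v0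
    rw [← intervalIntegral.integral_const_mul, ← intervalIntegral.integral_const_mul,
      ← intervalIntegral.integral_sub (Continuous.intervalIntegrable (by fun_prop) _ _)
      (Continuous.intervalIntegrable (by fun_prop) _ _)]
    refine intervalIntegral.integral_congr_ae (ae_of_all _ fun r hr => ?_)
    rw [uIoc_of_le hN.le] at hr
    exact hHr r hr.1
  rw [← hlhs, hswap]
  refine intervalIntegral.integral_mono_on_of_le_Ioo hv ?_ ?_ fun w hw => ?_
  · refine Continuous.intervalIntegrable ?_ _ _
    exact intervalIntegral.continuous_parametric_intervalIntegral_of_continuous'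
      (f := fun w r => H r w) (hHc.comp sw) _ _
  · refine Continuous.intervalIntegrable ?_ _ _
    have : Continuous fun w => ∫ r in rp..N, r * (X.φv w r ^ 2 + X.density w r) :=
      intervalIntegral.continuous_parametric_intervalIntegral_of_continuous'
        (f := fun w r => r * (X.φv w r ^ 2 + X.density w r))
        (show Continuous fun p : ℝ × ℝ => p.2 * (X.φv p.1 p.2 ^ 2 + X.density p.1 p.2) by
          fun_prop) _ _
    fun_prop
  · simp only [hH]
    rw [intervalIntegral.integral_const_mul]
    gcongr
    exact E.integral_cutoff_energyDeriv_le X hrp hw.1 hN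

end Decay


/-! ### Comparison with the flux, exponential decay and the pointwise bound -/

open Filter Topology

variable {M l a rp v0 : ℝ} {Ψ : ℝ → ℝ → ℝ}

theorem RescaledField.density_le (X : RescaledField M l a rp v0 Ψ) {v r : ℝ} (hv : v0 ≤ v)
    (hr : rp < r) : X.density v r ≤
      3 * (r ^ 4 * (deriv (fun s => Ψ v s) r) ^ 2 + r ^ 2 * (Ψ v r) ^ 2) := by
  rw [density, X.φr_eq v r hv hr, X.φ_eq v r hv hr.le]
  nlinarith [mul_nonneg (sq_nonneg r) (sq_nonneg (Ψ v r - r * deriv (fun s => Ψ v s) r)),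
    mul_nonneg (sq_nonneg r) (sq_nonneg (r * deriv (fun s => Ψ v s) r))]

theorem RescaledField.le_density (X : RescaledField M l a rp v0 Ψ) {v r : ℝ} (hv : v0 ≤ v)
    (hr : rp < r) : r ^ 4 * (deriv (fun s => Ψ v s) r) ^ 2 + r ^ 2 * (Ψ v r) ^ 2 ≤
      3 * X.density v r := by
  rw [density, X.φr_eq v r hv hr, X.φ_eq v r hv hr.le]
  nlinarith [mul_nonneg (sq_nonneg r) (sq_nonneg (2 * Ψ v r + r * deriv (fun s => Ψ v s) r))]

theorem RescaledField.lintegral_density_le (X : RescaledField M l a rp v0 Ψ) {v : ℝ}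
    (hv : v0 ≤ v) :
    ∫⁻ r in Ioi rp, ENNReal.ofReal (X.density v r) ≤ 3 * flux rp Ψ v := by
  rw [flux, ← lintegral_const_mul' _ _ (by norm_num)]
  refine setLIntegral_mono' measurableSet_Ioi fun r hr => ?_
  rw [← ENNReal.ofReal_ofNat, ← ENNReal.ofReal_mul (by norm_num)]
  exact ENNReal.ofReal_le_ofReal (X.density_le hv hr)

theorem RescaledField.flux_le (X : RescaledField M l a rp v0 Ψ) {v : ℝ} (hv : v0 ≤ v) :
    flux rp Ψ v ≤ 3 * ∫⁻ r in Ioi rp, ENNReal.ofReal (X.density v r) := by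
  rw [flux, ← lintegral_const_mul' _ _ (by norm_num)]
  refine setLIntegral_mono' measurableSet_Ioi fun r hr => ?_
  rw [← ENNReal.ofReal_ofNat, ← ENNReal.ofReal_mul (by norm_num)]
  exact ENNReal.ofReal_le_ofReal (X.le_density hv hr)

theorem RescaledField.lintegral_sq_φv_le (X : RescaledField M l a rp v0 Ψ) {v : ℝ} (hv : v0 ≤ v) :
    ∫⁻ r in Ioi rp, ENNReal.ofReal (X.φv v r ^ 2) ≤ flux rp (killingDeriv v0 Ψ) v := by
  refine setLIntegral_mono' measurableSet_Ioi fun r hr => ?_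
  rw [X.φv_eq v r hv (le_of_lt hr), mul_pow]
  exact ENNReal.ofReal_le_ofReal (le_add_of_nonneg_left (by positivity))

theorem integrableOn_of_lintegral_ofReal_le {g : ℝ → ℝ} (hg : Continuous g) (hg0 : ∀ r, 0 ≤ g r)
    {K : NNReal} (h : ∫⁻ r in Ioi rp, ENNReal.ofReal (g r) ≤ K) :
    IntegrableOn g (Ioi rp) ∧ ∫ r in Ioi rp, g r ≤ K := by
  have hi : IntegrableOn g (Ioi rp) := by
    refine ⟨hg.aestronglyMeasurable, ?_⟩
    rw [hasFiniteIntegral_iff_ofReal (ae_of_all _ hg0)]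
    exact h.trans_lt ENNReal.coe_lt_top
  refine ⟨hi, ?_⟩
  rw [integral_eq_lintegral_of_nonneg_ae (ae_of_all _ hg0) hg.aestronglyMeasurable]
  exact ENNReal.toReal_le_of_le_ofReal K.2 (by rwa [ENNReal.ofReal_coe_nnreal])

/-- Exponential decay of the energy of the rescaled field. -/
theorem EnergyCurrent.integral_density_le (E : EnergyCurrent M l a rp)
    (X : RescaledField M l a rp v0 Ψ) (hrp : 0 < rp) (h : IsSolution M l a rp v0 Ψ) {v : ℝ}
    (hv : v0 ≤ v) :
    ∫ r in Ioi rp, X.density v r ≤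
      E.c₂ / E.c₁ * Real.exp (-E.c₄ * (v - v0)) * ∫ r in Ioi rp, X.density v0 r := by
  obtain ⟨K₁, hK₁⟩ := h.flux_bounded v
  obtain ⟨K₂, hK₂⟩ := h.flux_killingDeriv_bounded v
  have cD : ∀ w, Continuous fun r => X.density w r := fun w =>
    X.continuous_density.comp (by fun_prop : Continuous fun r : ℝ => (w, r))
  have cv : ∀ w, Continuous fun r => X.φv w r := fun w =>
    X.continuous_φv.comp (by fun_prop : Continuous fun r : ℝ => (w, r))
  have hDi : ∀ w ∈ Icc v0 v, IntegrableOn (fun r => X.density w r) (Ioi rp) ∧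
      ∫ r in Ioi rp, X.density w r ≤ (3 * K₁ : NNReal) := fun w hw =>
    integrableOn_of_lintegral_ofReal_le (cD w) (X.density_nonneg w) (by
      push_cast
      exact (X.lintegral_density_le hw.1).trans (by gcongr; exact hK₁ w hw))
  have hvi : ∀ w ∈ Icc v0 v, IntegrableOn (fun r => X.φv w r ^ 2) (Ioi rp) ∧
      ∫ r in Ioi rp, X.φv w r ^ 2 ≤ K₂ := fun w hw =>
    integrableOn_of_lintegral_ofReal_le ((cv w).pow 2) (fun r => sq_nonneg _)
      ((X.lintegral_sq_φv_le hw.1).trans (hK₂ w hw))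
  set g : ℝ → ℝ → ℝ := fun w r => X.φv w r ^ 2 + X.density w r with hg
  have hgc : ∀ w, Continuous (g w) := fun w => ((cv w).pow 2).add (cD w)
  have hg0 : ∀ w r, 0 ≤ g w r := fun w r => add_nonneg (sq_nonneg _) (X.density_nonneg w r)
  have hgi : ∀ w ∈ Icc v0 v, IntegrableOn (g w) (Ioi rp) ∧
      ∫ r in Ioi rp, g w r ≤ K₂ + (3 * K₁ : NNReal) := by
    intro w hw
    refine ⟨(hvi w hw).1.add (hDi w hw).1, ?_⟩
    rw [hg, integral_add (hvi w hw).1 (hDi w hw).1]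
    exact add_le_add (hvi w hw).2 (hDi w hw).2
  set K : ℝ := K₂ + (3 * K₁ : NNReal) with hK
  -- For each w the average vanishes as N grows; the flux bounds, uniform on [v0, v], give the
  -- dominating function for the integral in w.
  have herr : Tendsto (fun N : ℝ => ∫ w in v0..v, Real.exp (E.c₄ * w) *
      (E.c₃ * (1 / N * ∫ r in rp..N, r * g w r))) atTop (𝓝 (∫ _ in v0..v, (0 : ℝ))) := by
    refine intervalIntegral.tendsto_integral_filter_of_dominated_convergence
      (fun w => Real.exp (E.c₄ * w) * (E.c₃ * K)) ?_ ?_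
      (Continuous.intervalIntegrable (by fun_prop) _ _) ?_
    · refine Eventually.of_forall fun N => ?_
      have c3 := X.continuous_density
      have c4 := X.continuous_φv
      have : Continuous fun w => ∫ r in rp..N, r * g w r :=
        intervalIntegral.continuous_parametric_intervalIntegral_of_continuous'
          (f := fun w r => r * g w r)
          (show Continuous fun p : ℝ × ℝ => p.2 * (X.φv p.1 p.2 ^ 2 + X.density p.1 p.2) by
            fun_prop) _ _
      exact (by fun_prop : Continuous fun w => Real.exp (E.c₄ * w) *
        (E.c₃ * (1 / N * ∫ r in rp..N, r * g w r))).aestronglyMeasurable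
    · filter_upwards [eventually_gt_atTop rp] with N hN
      refine ae_of_all _ fun w hw => ?_
      rw [uIoc_of_le hv] at hw
      have hw' : w ∈ Icc v0 v := ⟨hw.1.le, hw.2⟩
      have h1 := average_mul_nonneg hrp (hg0 w) hN
      have h2 := (average_mul_le hrp (hgc w) (hg0 w) (hgi w hw').1 hN).trans (hgi w hw').2
      have h3 := E.c₃_pos
      rw [Real.norm_of_nonneg (by positivity)]
      gcongr
    · refine ae_of_all _ fun w hw => ?_
      rw [uIoc_of_le hv] at hw
      have := ((tendsto_average_mul hrp (hgc w) (hg0 w) (hgi w ⟨hw.1.le, hw.2⟩).1).const_mul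
        E.c₃).const_mul (Real.exp (E.c₄ * w))
      simpa using this
  rw [intervalIntegral.integral_zero] at herr
  have hmain : ∀ N : ℝ, rp < N →
      Real.exp (E.c₄ * v) * (E.c₁ * ∫ r in rp..N, (1 - r / N) * X.density v r) -
        Real.exp (E.c₄ * v0) * (E.c₂ * ∫ r in rp..N, (1 - r / N) * X.density v0 r) ≤
      ∫ w in v0..v, Real.exp (E.c₄ * w) * (E.c₃ * (1 / N * ∫ r in rp..N, r * g w r)) := by
    intro N hN
    have hN0 : 0 < N := hrp.trans hN
    have cE : ∀ w, Continuous fun r => E.energy X w r := fun w =>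
      (E.continuous_energy X).comp (by fun_prop : Continuous fun r : ℝ => (w, r))
    have h1 : E.c₁ * ∫ r in rp..N, (1 - r / N) * X.density v r ≤
        ∫ r in rp..N, (1 - r / N) * E.energy X v r := by
      rw [← intervalIntegral.integral_const_mul]
      have e1 := cD v
      have e2 := cE v
      refine intervalIntegral.integral_mono_on hN.le (Continuous.intervalIntegrable (by fun_prop) _ _)
        (Continuous.intervalIntegrable (by fun_prop) _ _) fun r hr => ?_
      have h0 : 0 ≤ 1 - r / N := sub_nonneg.2 ((div_le_one hN0).2 hr.2)
      rw [mul_left_comm]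
      gcongr
      exact E.density_le_energy X hr.1
    have h2 : ∫ r in rp..N, (1 - r / N) * E.energy X v0 r ≤
        E.c₂ * ∫ r in rp..N, (1 - r / N) * X.density v0 r := by
      rw [← intervalIntegral.integral_const_mul]
      have e1 := cD v0
      have e2 := cE v0
      refine intervalIntegral.integral_mono_on hN.le (Continuous.intervalIntegrable (by fun_prop) _ _)
        (Continuous.intervalIntegrable (by fun_prop) _ _) fun r hr => ?_
      have h0 : 0 ≤ 1 - r / N := sub_nonneg.2 ((div_le_one hN0).2 hr.2)
      rw [mul_left_comm E.c₂]
      gcongr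
      exact E.energy_le_density X hr.1
    refine le_trans ?_ (E.cutoff_energy_le X hrp hv hN)
    gcongr
  have hlim := (((tendsto_cutoff_integral hrp (cD v) (X.density_nonneg v)
    (hDi v ⟨hv, le_rfl⟩).1).const_mul E.c₁).const_mul (Real.exp (E.c₄ * v))).sub
    (((tendsto_cutoff_integral hrp (cD v0) (X.density_nonneg v0)
    (hDi v0 ⟨le_rfl, hv⟩).1).const_mul E.c₂).const_mul (Real.exp (E.c₄ * v0)))
  have hle := le_of_tendsto_of_tendsto hlim herr
    ((eventually_gt_atTop rp).mono fun N hN => hmain N hN)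
  have h1 := E.c₁_pos
  have hexp : Real.exp (-E.c₄ * (v - v0)) = Real.exp (E.c₄ * v0) / Real.exp (E.c₄ * v) := by
    rw [← Real.exp_sub]
    congr 1
    ring
  rw [hexp]
  have h2 := Real.exp_pos (E.c₄ * v)
  rw [div_mul_div_comm, div_mul_eq_mul_div, le_div_iff₀ (by positivity)]
  linarith

/-- The pointwise bound by the energy on the cone. -/
theorem RescaledField.mul_sq_le (X : RescaledField M l a rp v0 Ψ) (hrp : 0 < rp) {v r : ℝ}
    (hv : v0 ≤ v) (hr : rp ≤ r) (hi : IntegrableOn (fun r => X.density v r) (Ioi rp)) :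
    r * X.φ v r ^ 2 ≤ 4 * ∫ r in Ioi rp, X.density v r := by
  have hr0 : 0 < r := hrp.trans_le hr
  have cD : Continuous fun r => X.density v r :=
    X.continuous_density.comp (by fun_prop : Continuous fun r : ℝ => (v, r))
  have c5 : Continuous fun r => X.φr v r :=
    X.continuous_φr.comp (by fun_prop : Continuous fun r : ℝ => (v, r))
  have c6 : Continuous fun r => X.φ v r :=
    X.continuous_φ.comp (by fun_prop : Continuous fun r : ℝ => (v, r))
  -- The linear factor equals 1 at s = r and 0 at s = 2r, so G(r) = rφ(r)² is recovered from -G' ≤ 4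
  -- · density on [r, 2r], with no limit at infinity needed.
  set G : ℝ → ℝ := fun s => (2 - s / r) * (s * X.φ v s ^ 2) with hG
  have hle := intervalIntegral.integral_le_sub_of_hasDeriv_right_of_le (a := r) (b := 2 * r)
    (g := G) (φ := fun s => -4 * X.density v s)
    (g' := fun s => -(1 / r) * (s * X.φ v s ^ 2) + (2 - s / r) *
      (1 * X.φ v s ^ 2 + s * (2 * X.φ v s * X.φr v s))) (by linarith)
    (by fun_prop : Continuous G).continuousOn (fun s hs => ?_)
    (by fun_prop : Continuous fun s => -4 * X.density v s).continuousOn.integrableOn_Icc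
    fun s hs => ?_
  · have h2 : G (2 * r) = 0 := by
      simp only [hG]
      rw [mul_div_assoc, div_self hr0.ne']
      ring
    have h3 : G r = r * X.φ v r ^ 2 := by
      simp only [hG]
      rw [div_self hr0.ne']
      ring
    rw [h2, h3, intervalIntegral.integral_const_mul, intervalIntegral.integral_of_le (by linarith)]
      at hle
    have h4 : ∫ s in Ioc r (2 * r), X.density v s ≤ ∫ s in Ioi rp, X.density v s :=
      setIntegral_mono_set hi (ae_of_all _ (X.density_nonneg v))
        (LE.le.eventuallyLE fun s hs => hr.trans_lt hs.1)
    linarith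
  · have hd := X.hasDerivAt_φ_r v s hv (hr.trans_lt hs.1)
    have h1 : HasDerivAt (fun s : ℝ => 2 - s / r) (-(1 / r)) s :=
      ((hasDerivAt_id s).div_const r).const_sub 2
    exact (((h1.mul ((hasDerivAt_id s).mul (hd.pow 2))).congr_deriv (by simp)).hasDerivWithinAt)
  · have hs0 : 0 < s := hr0.trans hs.1
    have h0 : 0 ≤ 2 - s / r := sub_nonneg.2 ((div_le_iff₀ hr0).2 hs.2.le)
    have h1 : 2 - s / r ≤ 1 := by
      have : 1 ≤ s / r := (one_le_div hr0).2 hs.1.le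
      linarith
    have h2 : 1 / r * s ≤ 2 := by
      rw [one_div_mul_eq_div]
      linarith
    have h3 : -(1 / r) * (s * X.φ v s ^ 2) ≥ -(2 * X.φ v s ^ 2) := by
      have := mul_le_mul_of_nonneg_right h2 (sq_nonneg (X.φ v s))
      linarith
    have h4 : -(s ^ 2 * X.φr v s ^ 2) ≤ 1 * X.φ v s ^ 2 + s * (2 * X.φ v s * X.φr v s) := by
      nlinarith [sq_nonneg (X.φ v s + s * X.φr v s)]
    have h5 : (2 - s / r) * -(s ^ 2 * X.φr v s ^ 2) ≥ -(s ^ 2 * X.φr v s ^ 2) := by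
      have : 0 ≤ s ^ 2 * X.φr v s ^ 2 := by positivity
      nlinarith
    have h6 := mul_le_mul_of_nonneg_left h4 h0
    have h7 : 0 ≤ s ^ 2 * X.φr v s ^ 2 := by positivity
    simp only [density]
    nlinarith [sq_nonneg (X.φ v s)]

end SchwarzschildAdS
end

theorem corollary3p1 (M l a rp : ℝ) (hM : 0 < M) (hl : 0 < l) (ha : -1 ≤ a)
    (hrp : 0 < rp) (hhor : SchwarzschildAdS.lapse M l rp = 0) :
    ∃ B c : ℝ, 0 < B ∧ 0 < c ∧
      ∀ (v0 : ℝ) (Ψ : ℝ → ℝ → ℝ), SchwarzschildAdS.IsSolution M l a rp v0 Ψ →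
        (∀ v : ℝ, v0 ≤ v →
          SchwarzschildAdS.flux rp Ψ v ≤
            ENNReal.ofReal (B * Real.exp (-c * (v - v0))) * SchwarzschildAdS.flux rp Ψ v0) ∧
        (∀ v r : ℝ, v0 ≤ v → rp ≤ r →
          |Ψ v r| ≤ B * Real.exp (-c * (v - v0)) *
            Real.sqrt (SchwarzschildAdS.flux rp Ψ v0).toReal / r ^ (3 / 2 : ℝ)) := by
  obtain ⟨E⟩ := SchwarzschildAdS.nonempty_energyCurrent (a := a) hM hl ha hrp hhor
  have hc₁ := E.c₁_pos
  have hc₂ := E.c₂_pos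
  have hc₄ := E.c₄_pos
  set k := E.c₂ / E.c₁ with hk
  have hkpos : 0 < k := by positivity
  -- The 9 is 3 · 3 from passing between flux and density in both directions; the 12 is 4 · 3 from
  -- the pointwise estimate and one such passage. The rate is halved because the pointwise bound
  -- takes a square root of the energy.
  refine ⟨max (9 * k) (Real.sqrt (12 * k)), E.c₄ / 2, lt_max_of_lt_left (by positivity),
    by positivity, fun v0 Ψ h => ?_⟩
  obtain ⟨X⟩ := h.nonempty_rescaledField hl hrp
  have hfin : ∀ v, v0 ≤ v → SchwarzschildAdS.flux rp Ψ v ≠ ⊤ := fun v hv => by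
    obtain ⟨K, hK⟩ := h.flux_bounded v
    exact ((hK v ⟨hv, le_rfl⟩).trans_lt ENNReal.coe_lt_top).ne
  have cD : ∀ v, Continuous fun r => X.density v r := fun v =>
    X.continuous_density.comp (by fun_prop : Continuous fun r : ℝ => (v, r))
  have hint : ∀ v, v0 ≤ v → IntegrableOn (fun r => X.density v r) (Ioi rp) ∧
      ∫ r in Ioi rp, X.density v r ≤ 3 * (SchwarzschildAdS.flux rp Ψ v).toReal := by
    intro v hv
    have := SchwarzschildAdS.integrableOn_of_lintegral_ofReal_le (rp := rp) (cD v)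
      (X.density_nonneg v) (K := 3 * (SchwarzschildAdS.flux rp Ψ v).toNNReal) (by
        push_cast
        rw [ENNReal.coe_toNNReal (hfin v hv)]
        exact X.lintegral_density_le hv)
    exact ⟨this.1, this.2.trans_eq (by push_cast; rfl)⟩
  have hdecay : ∀ v, v0 ≤ v → ∫ r in Ioi rp, X.density v r ≤
      3 * k * Real.exp (-E.c₄ * (v - v0)) * (SchwarzschildAdS.flux rp Ψ v0).toReal := by
    intro v hv
    refine (E.integral_density_le X hrp h hv).trans ?_
    calc k * Real.exp (-E.c₄ * (v - v0)) * ∫ r in Ioi rp, X.density v0 r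
        ≤ k * Real.exp (-E.c₄ * (v - v0)) * (3 * (SchwarzschildAdS.flux rp Ψ v0).toReal) := by
          gcongr
          exact (hint v0 le_rfl).2
      _ = _ := by ring
  refine ⟨fun v hv => ?_, fun v r hv hr => ?_⟩
  · refine (X.flux_le hv).trans ?_
    rw [← ofReal_integral_eq_lintegral_ofReal (hint v hv).1
      (ae_of_all _ (X.density_nonneg v)), ← ENNReal.ofReal_toReal (hfin v0 le_rfl),
      ← ENNReal.ofReal_ofNat, ← ENNReal.ofReal_mul (by norm_num), ← ENNReal.ofReal_mul
      (by positivity)]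
    refine ENNReal.ofReal_le_ofReal ?_
    have hexp : Real.exp (-E.c₄ * (v - v0)) ≤ Real.exp (-(E.c₄ / 2) * (v - v0)) := by
      apply Real.exp_le_exp.2
      nlinarith [mul_nonneg hc₄.le (sub_nonneg.2 hv)]
    calc 3 * ∫ r in Ioi rp, X.density v r
        ≤ 3 * (3 * k * Real.exp (-E.c₄ * (v - v0)) * (SchwarzschildAdS.flux rp Ψ v0).toReal) := by
          gcongr
          exact hdecay v hv
      _ = 9 * k * Real.exp (-E.c₄ * (v - v0)) * (SchwarzschildAdS.flux rp Ψ v0).toReal := by ring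
      _ ≤ _ := by
          gcongr
          exact le_max_left _ _
  · have hr0 : 0 < r := hrp.trans_le hr
    set F := (SchwarzschildAdS.flux rp Ψ v0).toReal with hF
    have hF0 : 0 ≤ F := ENNReal.toReal_nonneg
    have h1 := X.mul_sq_le hrp hv hr (hint v hv).1
    have h2 := hdecay v hv
    rw [X.φ_eq v r hv hr] at h1
    set e := Real.exp (-(E.c₄ / 2) * (v - v0)) with he
    have he2 : Real.exp (-E.c₄ * (v - v0)) = e ^ 2 := by
      rw [he, ← Real.exp_nat_mul]
      congr 1
      push_cast
      ring
    rw [he2] at h2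
    have hr32 : r ^ (3 / 2 : ℝ) = r * Real.sqrt r := by
      rw [Real.sqrt_eq_rpow, ← Real.rpow_one_add' hr0.le (by norm_num)]
      norm_num
    have hpos : 0 < r * Real.sqrt r := mul_pos hr0 (Real.sqrt_pos.2 hr0)
    rw [hr32, le_div_iff₀ hpos]
    have h3 : |Ψ v r| * (r * Real.sqrt r) ≤ Real.sqrt (12 * k) * e * Real.sqrt F := by
      have he0 : 0 ≤ e := (Real.exp_pos _).le
      refine le_of_sq_le_sq ?_ (by positivity)
      rw [mul_pow, mul_pow, mul_pow, mul_pow, sq_abs, Real.sq_sqrt hr0.le,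
        Real.sq_sqrt (by positivity), Real.sq_sqrt hF0]
      calc Ψ v r ^ 2 * (r ^ 2 * r) = r * (r * Ψ v r) ^ 2 := by ring
        _ ≤ 4 * (3 * k * e ^ 2 * F) := h1.trans (by gcongr)
        _ = _ := by ring
    refine h3.trans ?_
    gcongr
    exact le_max_right _ _
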